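/- A tiling of the plane by triangles is a collection of nondegenerate triangles that cover $\mathbb{R}^2$ and have pairwise disjoint interiors; it is vertex-to-vertex if any two distinct tiles meet in an entire edge of both, in a vertex of both, or not at all, and periodic if it is invariant under translation by two linearly independent vectors. For $\varepsilon>0$, two tilings by triangles are $\varepsilon$-close if there is a bijection between their tiles and, for each pair of corresponding tiles, a bijection between their vertices such that the respective coordinates of corresponding vertices differ by at most $\varepsilon$. Congruence means congruence under Euclidean isometries, reflections included. Let $s=2/\sqrt[4]{3}$, $p_{m,n}=\bigl(s(m+\tfrac n2),\, s\tfrac{\sqrt3}{2}n\bigr)$ for $m,n\in\mathbb{Z}$, and let $\mathcal{T}_0$ be the collection of all triangles with vertices $p_{m,n},p_{m+1,n},p_{m,n+1}$ or $p_{m+1,n+1},p_{m,n+1},p_{m+1,n}$, where $m,n\in\mathbb{Z}$. Theorem. $\mathcal{T}_0$ is a periodic vertex-to-vertex tiling of the plane by equilateral triangles of unit area. For all $\varepsilon>0$ and $\delta>0$ there is a vertex-to-vertex tiling $\mathcal{T}$ of the plane by pairwise incongruent, non-equilateral triangles of unit area that is $\varepsilon$-close to $\mathcal{T}_0$ and in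 which the ratio of the perimeters of any two tiles is at most $1+\delta$. In particular, the ratio of the largest to the smallest perimeter (supremum to infimum) can be made arbitrarily close to $1$. -/

import Mathlib

/-- The Euclidean plane. -/
abbrev Plane : Type := EuclideanSpace ℝ (Fin 2)

/-- A nondegenerate triangle, with its vertices listed in some order. -/
abbrev PlaneTriangle : Type := Affine.Triangle ℝ Plane

namespace PlaneTriangle

/-- The tile (a compact subset of the plane) given by a triangle: the convex hull of its vertices. -/
def tile (t : PlaneTriangle) : Set Plane := convexHull ℝ (Set.range t.points)

/-- The perimeter of a triangle. -/
noncomputable def perimeter (t : PlaneTriangle) : ℝ :=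
  dist (t.points 0) (t.points 1) + dist (t.points 1) (t.points 2) + dist (t.points 2) (t.points 0)

/-- Congruence under Euclidean isometries, including reflections. -/
def IsCongruent (t t' : PlaneTriangle) : Prop :=
  ∃ φ : Plane ≃ᵢ Plane, φ '' t.tile = t'.tile

/-- The tiles of `t` and `t'` have a common vertex, and meet in that vertex only. -/
def MeetInVertex (t t' : PlaneTriangle) : Prop :=
  ∃ i i' : Fin 3, t.points i = t'.points i' ∧ t.tile ∩ t'.tile = {t.points i}

/-- The tiles of `t` and `t'` have a common entire edge, and meet exactly in that edge. -/
def MeetInEdge (t t' : PlaneTriangle) : Prop :=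
  ∃ i j i' j' : Fin 3, i ≠ j ∧ t.points i = t'.points i' ∧ t.points j = t'.points j' ∧
    t.tile ∩ t'.tile = segment ℝ (t.points i) (t.points j)

end PlaneTriangle

/-- A set of triangles is a tiling of the plane if the tiles cover the plane and the interiors of
distinct members are disjoint. (In particular the same tile cannot occur twice with differently
ordered vertices.) -/
def IsTriangleTiling (𝒯 : Set PlaneTriangle) : Prop :=
  (⋃ t ∈ 𝒯, t.tile) = Set.univ ∧
    ∀ t ∈ 𝒯, ∀ t' ∈ 𝒯, t ≠ t' → Disjoint (interior t.tile) (interior t'.tile)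

/-- Any two tiles meet in an entire edge of both, in a vertex of both, or not at all. -/
def IsVertexToVertex (𝒯 : Set PlaneTriangle) : Prop :=
  ∀ t ∈ 𝒯, ∀ t' ∈ 𝒯, t ≠ t' →
    t.MeetInEdge t' ∨ t.MeetInVertex t' ∨ t.tile ∩ t'.tile = ∅

/-- All tiles have area one. -/
def HasUnitArea (𝒯 : Set PlaneTriangle) : Prop :=
  ∀ t ∈ 𝒯, MeasureTheory.volume t.tile = 1

/-- The collection of tiles is invariant under two linearly independent translations. -/
def IsPeriodicTiling (𝒯 : Set PlaneTriangle) : Prop :=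
  ∃ v : Fin 2 → Plane, LinearIndependent ℝ v ∧
    ∀ k, (fun A : Set Plane => (fun x => v k + x) '' A) '' (PlaneTriangle.tile '' 𝒯) =
      PlaneTriangle.tile '' 𝒯

/-- Two tilings by triangles are `ε`-close if there is a bijection between them such that the
vertices of any two corresponding triangles can be matched so that the coordinates of matched
vertices differ by at most `ε`. -/
def AreClose (ε : ℝ) (𝒯 𝒯' : Set PlaneTriangle) : Prop :=
  ∃ e : 𝒯 ≃ 𝒯', ∀ t : 𝒯, ∃ σ : Equiv.Perm (Fin 3), ∀ (i : Fin 3) (k : Fin 2),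
    |(t : PlaneTriangle).points i k - (e t : PlaneTriangle).points (σ i) k| ≤ ε

/-- The edge length of the equilateral triangle of unit area: `(√3 / 4) * unitSide ^ 2 = 1`. -/
noncomputable def unitSide : ℝ := 2 / √(√3)

/-- The point with integer coordinates `(m, n)` of the triangular lattice spanned by
`unitSide • (1, 0)` and `unitSide • (1 / 2, √3 / 2)`. -/
noncomputable def latticePoint (m n : ℤ) : Plane :=
  !₂[unitSide * (m + n / 2), unitSide * (√3 / 2 * n)]

/-- The tiling of the plane by the upward and downward equilateral triangles of unit area whose
vertices are the points of the triangular lattice. -/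
def equilateralTiling : Set PlaneTriangle :=
  {t | ∃ m n : ℤ,
    t.points = ![latticePoint m n, latticePoint (m + 1) n, latticePoint m (n + 1)] ∨
    t.points = ![latticePoint (m + 1) (n + 1), latticePoint m (n + 1), latticePoint (m + 1) n]}

/-! In lattice coordinates the tiling becomes the standard triangulation of the plane with vertex
set `ℤ × ℤ`, and the task is to displace the lattice points slightly so that every triangle keeps
its area. To first order this is solved by shears: slide the strips between consecutive rows,
columns and diagonals along themselves by arbitrary amounts `x n`, `y m`, `z k`. Write the bottom
edge of an upward triangle as `(1 + c, b - c)` and its left edge as `(a + c', 1 - c')`. Then the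
area is preserved exactly when `c - c' = b * a + b * c' - c * a`, so the three waves pass through
each other up to a quadratic interaction in every triangle.

The interaction terms `Q` determine the waves by summation along strips, and the waves determine `Q`
by the quadratic formula. This fixed point problem is solved by iteration from `0`. With data
bounded by the summable weight `quadWeight`, products of waves are bounded by `interactionWeight`,
and the inequality `quadWeight_mul_le` shows that summing this along any strip gives back a multiple
of the weight of the strip. Hence `step` preserves a ball and contracts there (`bounded_step`,
`bounded_step_sub`).

For data `t • (x, y, z)` the solution is holomorphic in the small complex parameter `t`
(`differentiableOn_limit`). The deviation of a triangle from equilaterality, `tileDefect`, is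
symmetric in the sides and has leading coefficient `(y + z) ^ 2 + (x - z) ^ 2 + (x + y) ^ 2` at `t ^
2`. Data built from powers of a transcendental number make these coefficients nonzero and pairwise
distinct (`exists_generic_data`). By the identity theorem only countably many `t` let some defect
vanish or two defects agree, so a small real `t` avoids them all (`exists_solution`).

The resulting displacement is bounded and has small differences between neighbours. Its piecewise
linear extension is the identity plus a contraction, hence a bijection of the plane
(`plMap_bijective`), and it carries the standard triangulation to a vertex-to-vertex tiling.
Distinct defects exclude congruence, nonzero defects exclude equilateral tiles, and small waves give
closeness and nearly equal perimeters. -/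

/-! ### Discrete primitives on the integers -/

/-- The signed partial sums, starting at `0`, of a function on the integers. -/
noncomputable def intPrimitive {E : Type*} [AddCommGroup E] (f : ℤ → E) (n : ℤ) : E :=
  ∑ i ∈ Finset.Ico 0 n, f i - ∑ i ∈ Finset.Ico n 0, f i

section IntPrimitive

variable {E : Type*}

@[simp]
theorem intPrimitive_zero_right [AddCommGroup E] (f : ℤ → E) : intPrimitive f 0 = 0 := by
  simp [intPrimitive]

theorem intPrimitive_add_one [AddCommGroup E] (f : ℤ → E) (n : ℤ) :
    intPrimitive f (n + 1) = intPrimitive f n + f n := by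
  unfold intPrimitive
  rcases le_or_gt 0 n with h | h
  · have h1 : Finset.Ico 0 (n + 1) = insert n (Finset.Ico 0 n) := by
      ext i; simp only [Finset.mem_Ico, Finset.mem_insert]; omega
    rw [h1, Finset.sum_insert (by simp), Finset.Ico_eq_empty (a := n + 1) (by omega),
      Finset.Ico_eq_empty (a := n) (by omega)]
    simp [add_comm]
  · have h1 : Finset.Ico n 0 = insert n (Finset.Ico (n + 1) 0) := by
      ext i; simp only [Finset.mem_Ico, Finset.mem_insert]; omega
    rw [h1, Finset.sum_insert (by simp), Finset.Ico_eq_empty (a := 0) (by omega),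
      Finset.Ico_eq_empty (a := 0) (by omega)]
    simp

theorem intPrimitive_sub [AddCommGroup E] (f g : ℤ → E) (n : ℤ) :
    intPrimitive (fun i => f i - g i) n = intPrimitive f n - intPrimitive g n := by
  unfold intPrimitive
  rw [Finset.sum_sub_distrib, Finset.sum_sub_distrib]
  abel

/-- One of the two sums in `intPrimitive` is always empty, so a single total mass suffices for both
signs of `n`. -/
theorem norm_intPrimitive_le [NormedAddCommGroup E] {f : ℤ → E} {g : ℤ → ℝ} (hg : Summable g)
    (hfg : ∀ i, ‖f i‖ ≤ g i) (n : ℤ) : ‖intPrimitive f n‖ ≤ ∑' i, g i := by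
  have h0 : ∀ i, 0 ≤ g i := fun i => (norm_nonneg _).trans (hfg i)
  have key : ∀ s : Finset ℤ, ‖∑ i ∈ s, f i‖ ≤ ∑' i, g i := fun s =>
    (norm_sum_le_of_le s fun i _ => hfg i).trans (hg.sum_le_tsum s fun i _ => h0 i)
  unfold intPrimitive
  rcases le_or_gt 0 n with h | h
  · rw [Finset.Ico_eq_empty (a := n) (by omega)]
    simpa using key _
  · rw [Finset.Ico_eq_empty (a := 0) (by omega)]
    simpa using key _

theorem tendsto_intPrimitive [NormedAddCommGroup E] {ι : Type*} {l : Filter ι} {f : ι → ℤ → E}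
    {g : ℤ → E} (h : ∀ i, Filter.Tendsto (fun j => f j i) l (nhds (g i))) (n : ℤ) :
    Filter.Tendsto (fun j => intPrimitive (f j) n) l (nhds (intPrimitive g n)) :=
  (tendsto_finsetSum _ fun i _ => h i).sub (tendsto_finsetSum _ fun i _ => h i)

theorem im_intPrimitive_eq_zero {f : ℤ → ℂ} (h : ∀ i, (f i).im = 0) (n : ℤ) :
    (intPrimitive f n).im = 0 := by
  simp [intPrimitive, h]

end IntPrimitive

/-! ### Summable weights and their products along strips -/

/-- A summable weight on the integers that decays quadratically. -/
noncomputable def quadWeight (n : ℤ) : ℝ := 1 / (1 + (n : ℝ) ^ 2)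

section QuadWeight

local notation "w" => quadWeight

theorem quadWeight_pos (n : ℤ) : 0 < w n := by
  unfold quadWeight; positivity

theorem quadWeight_le_one (n : ℤ) : w n ≤ 1 := by
  unfold quadWeight
  rw [div_le_one (by positivity)]
  nlinarith [sq_nonneg (n : ℝ)]

theorem quadWeight_neg (n : ℤ) : w (-n) = w n := by
  simp [quadWeight]

theorem quadWeight_add_one_le (n : ℤ) : w (n + 1) ≤ 3 * w n := by
  unfold quadWeight
  rw [mul_one_div, div_le_div_iff₀ (by positivity) (by positivity)]
  push_cast
  nlinarith [sq_nonneg (2 * (n : ℝ) + 3), sq_nonneg ((n : ℝ) + 1)]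

theorem quadWeight_sub_one_le (n : ℤ) : w (n - 1) ≤ 3 * w n := by
  rw [← quadWeight_neg (n - 1), ← quadWeight_neg n]
  convert quadWeight_add_one_le (-n) using 2
  ring

/-- After clearing denominators this is `1 + (a + b) ^ 2 ≤ 2 * ((1 + a ^ 2) + (1 + b ^ 2))`. It is
the reason for a polynomially decaying weight: the product of two weights is controlled by the third
index of the triangle, with a summable factor left over. -/
theorem quadWeight_mul_le (a b : ℤ) : w a * w b ≤ 2 * w (a + b) * (w a + w b) := by
  unfold quadWeight
  have ha : 0 < 1 + (a : ℝ) ^ 2 := by positivity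
  have hb : 0 < 1 + (b : ℝ) ^ 2 := by positivity
  have hc : 0 < 1 + ((a : ℝ) + b) ^ 2 := by positivity
  push_cast
  have e : 2 * (1 / (1 + ((a : ℝ) + b) ^ 2)) * (1 / (1 + (a : ℝ) ^ 2) + 1 / (1 + (b : ℝ) ^ 2))
      = (2 * ((1 + (a : ℝ) ^ 2) + (1 + (b : ℝ) ^ 2)))
        / ((1 + ((a : ℝ) + b) ^ 2) * ((1 + (a : ℝ) ^ 2) * (1 + (b : ℝ) ^ 2))) := by
    field_simp
    ring
  rw [e, one_div_mul_one_div, div_le_div_iff₀ (by positivity) (by positivity)]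
  have : 1 + ((a : ℝ) + b) ^ 2 ≤ 2 * ((1 + (a : ℝ) ^ 2) + (1 + (b : ℝ) ^ 2)) := by
    nlinarith [sq_nonneg ((a : ℝ) - b)]
  rw [one_mul]
  exact mul_le_mul_of_nonneg_right this (by positivity)

theorem summable_quadWeight : Summable w := by
  -- The extra term covers `n = 0`, where `1 / n ^ 2` is `0` by convention but the weight is `1`.
  have h : Summable fun n : ℤ => 2 * (1 / (n : ℝ) ^ 2) + (if n = 0 then 1 else 0) := by
    refine ((Real.summable_one_div_int_pow.mpr (by norm_num)).mul_left 2).add ?_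
    exact summable_of_hasFiniteSupport ((Set.finite_singleton (0 : ℤ)).subset fun n hn => by
      by_contra h; simp at h; simp [h] at hn)
  refine h.of_nonneg_of_le (fun n => (quadWeight_pos n).le) fun n => ?_
  unfold quadWeight
  split_ifs with h0
  · subst h0; simp
  · have : (0 : ℝ) < (n : ℝ) ^ 2 := by positivity
    have h1 : 1 / (1 + (n : ℝ) ^ 2) ≤ 1 / (n : ℝ) ^ 2 :=
      one_div_le_one_div_of_le this (by linarith)
    have : 0 < 1 / (n : ℝ) ^ 2 := by positivity
    linarith

/-- The total mass of `quadWeight`. -/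
noncomputable def quadMass : ℝ := ∑' n, w n

theorem quadMass_nonneg : 0 ≤ quadMass := tsum_nonneg fun n => (quadWeight_pos n).le

theorem hasSum_quadWeight : HasSum w quadMass := summable_quadWeight.hasSum

theorem hasSum_quadWeight_add (a : ℤ) : HasSum (fun i => w (i + a)) quadMass :=
  ((Equiv.addRight a).hasSum_iff (f := quadWeight)).mpr hasSum_quadWeight

theorem hasSum_quadWeight_sub (a : ℤ) : HasSum (fun i => w (a - i)) quadMass :=
  ((Equiv.subLeft a).hasSum_iff (f := quadWeight)).mpr hasSum_quadWeight

/-- The weight controlling the interaction in the triangle with index `(m, n)`. -/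
noncomputable def interactionWeight (m n : ℤ) : ℝ :=
  w m * w n + w m * w (m + n) + w n * w (m + n)

local notation "W" => interactionWeight

theorem interactionWeight_nonneg (m n : ℤ) : 0 ≤ W m n := by
  have := quadWeight_pos m
  have := quadWeight_pos n
  have := quadWeight_pos (m + n)
  unfold interactionWeight; positivity

/-- Two of the three products contain `w n` already; the third is treated by `quadWeight_mul_le` at
`-m` and `m + n`, whose sum is `n`. Thus summation over `m` costs only a multiple of `w n`. Columns
and diagonals behave in the same way. -/
theorem interactionWeight_le_row (m n : ℤ) : W m n ≤ 3 * w n * (w m + w (m + n)) := by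
  have h := quadWeight_mul_le (-m) (m + n)
  rw [quadWeight_neg, neg_add_cancel_left] at h
  have h1 := mul_pos (quadWeight_pos m) (quadWeight_pos n)
  have h2 := mul_pos (quadWeight_pos n) (quadWeight_pos (m + n))
  unfold interactionWeight; linarith

theorem interactionWeight_le_column (m n : ℤ) : W m n ≤ 3 * w m * (w n + w (m + n)) := by
  have h := interactionWeight_le_row n m
  have e : W n m = W m n := by
    unfold interactionWeight; rw [add_comm n m]; ring
  rwa [e, add_comm n m] at h

theorem interactionWeight_le_diagonal (m n : ℤ) : W m n ≤ 3 * w (m + n) * (w m + w n) := by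
  have h := quadWeight_mul_le m n
  have h1 := mul_pos (quadWeight_pos m) (quadWeight_pos (m + n))
  have h2 := mul_pos (quadWeight_pos n) (quadWeight_pos (m + n))
  unfold interactionWeight; linarith

end QuadWeight

/-! ### The fixed point problem for interacting waves -/

section

local notation "w" => quadWeight
local notation "W" => interactionWeight

/-- Interaction terms in the upward (first component) and downward triangles. -/
abbrev Interaction : Type := (ℤ → ℤ → ℂ) × (ℤ → ℤ → ℂ)

namespace Interaction

/-- The wave carried by row `n`, on the left edge of the upward triangle `(m, n)`. -/
noncomputable def rowWave (x : ℤ → ℂ) (Q : Interaction) (m n : ℤ) : ℂ :=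
  x n + intPrimitive (fun i => Q.2 i n - Q.1 i n) m

/-- The wave carried by column `m`, on the bottom edge of the upward triangle `(m, n)`. -/
noncomputable def columnWave (y : ℤ → ℂ) (Q : Interaction) (m n : ℤ) : ℂ :=
  y m + intPrimitive (fun j => Q.2 m j - Q.1 m j) n

/-- The wave carried by the diagonal `m + n`, on the bottom edge of the upward triangle
`(m, n)`. -/
noncomputable def diagWave (z : ℤ → ℂ) (Q : Interaction) (m n : ℤ) : ℂ :=
  z (m + n) + intPrimitive (fun j => Q.2 (m + n - j - 1) j - Q.1 (m + n - j) j) n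

/-- The wave carried by the diagonal `m + n`, on the left edge of the upward triangle
`(m, n)`. -/
noncomputable def diagWaveLeft (z : ℤ → ℂ) (Q : Interaction) (m n : ℤ) : ℂ :=
  diagWave z Q m n - Q.1 m n

/-- The bilinear interaction of three waves meeting in a triangle. -/
def coupling (a b c c' : ℂ) : ℂ := b * a + b * c' - c * a

/-- The interaction terms generated by the waves. -/
noncomputable def step (x y z : ℤ → ℂ) (Q : Interaction) : Interaction :=
  (fun m n => coupling (rowWave x Q m n) (columnWave y Q m n) (diagWave z Q m n)
      (diagWaveLeft z Q m n),
    fun m n => coupling (rowWave x Q (m + 1) n) (columnWave y Q m (n + 1))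
      (diagWave z Q m (n + 1)) (diagWaveLeft z Q (m + 1) n))

/-- The interaction terms are bounded by `d` times the interaction weight. -/
def Bounded (d : ℝ) (Q : Interaction) : Prop :=
  ∀ m n, ‖Q.1 m n‖ ≤ d * W m n ∧ ‖Q.2 m n‖ ≤ d * W m n

/-- The constant relating the size of the waves to that of the interaction terms. -/
noncomputable def waveConst : ℝ := 24 * quadMass + 6

theorem waveConst_pos : 0 < waveConst := by
  have := quadMass_nonneg
  unfold waveConst; linarith

variable {x y z : ℤ → ℂ} {Q Q' : Interaction} {r d : ℝ}

theorem norm_rowWave_le (hx : ∀ n, ‖x n‖ ≤ r * w n) (hQ : Bounded d Q) (hd : 0 ≤ d) (m n : ℤ) :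
    ‖rowWave x Q m n‖ ≤ (r + waveConst * d) * w n := by
  have hs : HasSum (fun i => 6 * d * w n * (w i + w (i + n)))
      (6 * d * w n * (quadMass + quadMass)) :=
    (hasSum_quadWeight.add (hasSum_quadWeight_add n)).mul_left _
  have hp : ‖intPrimitive (fun i => Q.2 i n - Q.1 i n) m‖
      ≤ 6 * d * w n * (quadMass + quadMass) := by
    rw [← hs.tsum_eq]
    refine norm_intPrimitive_le hs.summable (fun i => ?_) m
    have h1 := norm_sub_le (Q.2 i n) (Q.1 i n)
    have h2 := hQ i n
    have h3 := mul_le_mul_of_nonneg_left (interactionWeight_le_row i n) hd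
    linarith
  have h := norm_add_le (x n) (intPrimitive (fun i => Q.2 i n - Q.1 i n) m)
  have hdw := mul_nonneg hd (quadWeight_pos n).le
  have hS := mul_nonneg hdw quadMass_nonneg
  have := hx n
  unfold rowWave waveConst
  linarith

theorem norm_columnWave_le (hy : ∀ n, ‖y n‖ ≤ r * w n) (hQ : Bounded d Q) (hd : 0 ≤ d)
    (m n : ℤ) : ‖columnWave y Q m n‖ ≤ (r + waveConst * d) * w m := by
  have hs : HasSum (fun i => 6 * d * w m * (w i + w (i + m)))
      (6 * d * w m * (quadMass + quadMass)) :=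
    (hasSum_quadWeight.add (hasSum_quadWeight_add m)).mul_left _
  have hp : ‖intPrimitive (fun j => Q.2 m j - Q.1 m j) n‖
      ≤ 6 * d * w m * (quadMass + quadMass) := by
    rw [← hs.tsum_eq]
    refine norm_intPrimitive_le hs.summable (fun i => ?_) n
    have h1 := norm_sub_le (Q.2 m i) (Q.1 m i)
    have h2 := hQ m i
    have h3 := mul_le_mul_of_nonneg_left (interactionWeight_le_column m i) hd
    rw [add_comm m i] at h3
    linarith
  have h := norm_add_le (y m) (intPrimitive (fun j => Q.2 m j - Q.1 m j) n)
  have hdw := mul_nonneg hd (quadWeight_pos m).le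
  have hS := mul_nonneg hdw quadMass_nonneg
  have := hy m
  unfold columnWave waveConst
  linarith

/-- The term `6 * d * w (m + n)` is reserved for the single interaction by which `diagWaveLeft`
differs from `diagWave`. The downward triangles that are summed lie on the diagonal `k - 1`, which
costs a factor `3` and turns `3` into `9`; together `2 * (9 + 3) = 24` explains `waveConst`. -/
theorem norm_diagWave_add_le (hz : ∀ n, ‖z n‖ ≤ r * w n) (hQ : Bounded d Q) (hd : 0 ≤ d)
    (m n : ℤ) : ‖diagWave z Q m n‖ + 6 * d * w (m + n) ≤ (r + waveConst * d) * w (m + n) := by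
  set k := m + n with hk
  have hs : HasSum (fun i => 9 * d * w k * (w (k - 1 - i) + w i) + 3 * d * w k * (w (k - i) + w i))
      (9 * d * w k * (quadMass + quadMass) + 3 * d * w k * (quadMass + quadMass)) :=
    (((hasSum_quadWeight_sub (k - 1)).add hasSum_quadWeight).mul_left _).add
      (((hasSum_quadWeight_sub k).add hasSum_quadWeight).mul_left _)
  have hp : ‖intPrimitive (fun j => Q.2 (k - j - 1) j - Q.1 (k - j) j) n‖
      ≤ 9 * d * w k * (quadMass + quadMass) + 3 * d * w k * (quadMass + quadMass) := by
    rw [← hs.tsum_eq]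
    refine norm_intPrimitive_le hs.summable (fun i => ?_) n
    have h1 := norm_sub_le (Q.2 (k - i - 1) i) (Q.1 (k - i) i)
    have h2 := (hQ (k - i - 1) i).2
    have h2' := (hQ (k - i) i).1
    have h3 := mul_le_mul_of_nonneg_left (interactionWeight_le_diagonal (k - i - 1) i) hd
    have h3' := mul_le_mul_of_nonneg_left (interactionWeight_le_diagonal (k - i) i) hd
    rw [show k - i - 1 + i = k - 1 by ring, show k - i - 1 = k - 1 - i by ring] at h3
    rw [show k - i - 1 = k - 1 - i by ring] at h1 h2 ⊢
    rw [sub_add_cancel] at h3'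
    have h4 := mul_le_mul_of_nonneg_left (quadWeight_sub_one_le k)
      (mul_nonneg hd (add_pos (quadWeight_pos (k - 1 - i)) (quadWeight_pos i)).le)
    linarith
  have h := norm_add_le (z k) (intPrimitive (fun j => Q.2 (k - j - 1) j - Q.1 (k - j) j) n)
  have := hz k
  unfold diagWave waveConst
  rw [← hk]
  linarith

theorem norm_diagWave_le (hz : ∀ n, ‖z n‖ ≤ r * w n) (hQ : Bounded d Q) (hd : 0 ≤ d)
    (m n : ℤ) : ‖diagWave z Q m n‖ ≤ (r + waveConst * d) * w (m + n) := by
  have h := norm_diagWave_add_le hz hQ hd m n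
  have := mul_nonneg hd (quadWeight_pos (m + n)).le
  linarith

theorem norm_diagWaveLeft_le (hz : ∀ n, ‖z n‖ ≤ r * w n) (hQ : Bounded d Q) (hd : 0 ≤ d)
    (m n : ℤ) : ‖diagWaveLeft z Q m n‖ ≤ (r + waveConst * d) * w (m + n) := by
  have h := norm_diagWave_add_le hz hQ hd m n
  have h1 := norm_sub_le (diagWave z Q m n) (Q.1 m n)
  have h2 := (hQ m n).1
  have h3 := mul_le_mul_of_nonneg_left (interactionWeight_le_diagonal m n) hd
  have h4 := mul_nonneg (mul_nonneg hd (quadWeight_pos (m + n)).le)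
    (by linarith [quadWeight_le_one m, quadWeight_le_one n] : 0 ≤ 2 - (w m + w n))
  unfold diagWaveLeft
  linarith

/-- The waves are affine in `Q`, so a difference of waves is a wave with zero data. The size
estimates therefore double as Lipschitz estimates. -/
theorem rowWave_sub (m n : ℤ) :
    rowWave x Q m n - rowWave x Q' m n = rowWave 0 (Q - Q') m n := by
  simp only [rowWave, Prod.fst_sub, Prod.snd_sub, Pi.sub_apply, intPrimitive_sub, Pi.zero_apply]
  ring

theorem columnWave_sub (m n : ℤ) :
    columnWave y Q m n - columnWave y Q' m n = columnWave 0 (Q - Q') m n := by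
  simp only [columnWave, Prod.fst_sub, Prod.snd_sub, Pi.sub_apply, intPrimitive_sub,
    Pi.zero_apply]
  ring

theorem diagWave_sub (m n : ℤ) :
    diagWave z Q m n - diagWave z Q' m n = diagWave 0 (Q - Q') m n := by
  simp only [diagWave, Prod.fst_sub, Prod.snd_sub, Pi.sub_apply, intPrimitive_sub, Pi.zero_apply]
  ring

theorem diagWaveLeft_sub (m n : ℤ) :
    diagWaveLeft z Q m n - diagWaveLeft z Q' m n = diagWaveLeft 0 (Q - Q') m n := by
  simp only [diagWaveLeft, ← diagWave_sub (z := z), Prod.fst_sub, Pi.sub_apply]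
  ring

/-- Every term of `coupling` multiplies waves of two different families; the three products of
weights are those of `interactionWeight`. A square of one wave would not decay along its own strip.
-/
theorem norm_coupling_le {a b c c' : ℂ} {R u v t : ℝ} (hR : 0 ≤ R) (hv : 0 ≤ v)
    (ht : 0 ≤ t) (ha : ‖a‖ ≤ R * u) (hb : ‖b‖ ≤ R * v) (hc : ‖c‖ ≤ R * t) (hc' : ‖c'‖ ≤ R * t) :
    ‖coupling a b c c'‖ ≤ R ^ 2 * (v * u + v * t + u * t) := by
  have h1 : ‖b * a‖ ≤ (R * v) * (R * u) := by
    rw [norm_mul]; exact mul_le_mul hb ha (norm_nonneg _) (by positivity)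
  have h2 : ‖b * c'‖ ≤ (R * v) * (R * t) := by
    rw [norm_mul]; exact mul_le_mul hb hc' (norm_nonneg _) (by positivity)
  have h3 : ‖c * a‖ ≤ (R * t) * (R * u) := by
    rw [norm_mul]; exact mul_le_mul hc ha (norm_nonneg _) (by positivity)
  have h4 := norm_sub_le (b * a + b * c') (c * a)
  have h5 := norm_add_le (b * a) (b * c')
  unfold coupling
  nlinarith

theorem norm_coupling_sub_le {a b c c' a₁ b₁ c₁ c₁' : ℂ} {R e u v t : ℝ}
    (ha : ‖a‖ ≤ R * u) (hc' : ‖c'‖ ≤ R * t)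
    (hb₁ : ‖b₁‖ ≤ R * v) (hc₁ : ‖c₁‖ ≤ R * t)
    (ea : ‖a - a₁‖ ≤ e * u) (eb : ‖b - b₁‖ ≤ e * v) (ec : ‖c - c₁‖ ≤ e * t)
    (ec' : ‖c' - c₁'‖ ≤ e * t) :
    ‖coupling a b c c' - coupling a₁ b₁ c₁ c₁'‖ ≤ 2 * R * e * (v * u + v * t + u * t) := by
  have e0 : coupling a b c c' - coupling a₁ b₁ c₁ c₁' =
      ((b - b₁) * a + b₁ * (a - a₁)) + ((b - b₁) * c' + b₁ * (c' - c₁'))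
        - ((c - c₁) * a + c₁ * (a - a₁)) := by
    unfold coupling; ring
  have key : ∀ {p q : ℂ} {s s' : ℝ}, ‖p‖ ≤ s → ‖q‖ ≤ s' → ‖p * q‖ ≤ s * s' := fun hp hq => by
    rw [norm_mul]
    exact mul_le_mul hp hq (norm_nonneg _) ((norm_nonneg _).trans hp)
  have h1 := norm_add_le_of_le (key eb ha) (key hb₁ ea)
  have h2 := norm_add_le_of_le (key eb hc') (key hb₁ ec')
  have h3 := norm_add_le_of_le (key ec ha) (key hc₁ ea)
  rw [e0]
  have h4 := norm_sub_le_of_le (norm_add_le_of_le h1 h2) h3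
  linarith

/-- The downward triangle `(m, n)` meets the diagonal `m + n + 1` instead of `m + n`; this shift is
the source of the factor `3` in `bounded_step`. -/
theorem weight_shift_le {u v k : ℝ} {m n : ℤ} (hu : u = w n) (hv : v = w m)
    (hk : k = w (m + n + 1)) : v * u + v * k + u * k ≤ 3 * W m n := by
  subst hu hv hk
  have h := quadWeight_add_one_le (m + n)
  have hm := quadWeight_pos m
  have hn := quadWeight_pos n
  have h1 := mul_le_mul_of_nonneg_left h hm.le
  have h2 := mul_le_mul_of_nonneg_left h hn.le
  have h3 := mul_pos hm hn
  unfold interactionWeight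
  linarith

theorem bounded_step (hx : ∀ n, ‖x n‖ ≤ r * w n) (hy : ∀ n, ‖y n‖ ≤ r * w n)
    (hz : ∀ n, ‖z n‖ ≤ r * w n) (hr : 0 ≤ r) (hd : 0 ≤ d) (hQ : Bounded d Q) :
    Bounded (3 * (r + waveConst * d) ^ 2) (step x y z Q) := by
  have hR : 0 ≤ r + waveConst * d := add_nonneg hr (mul_nonneg waveConst_pos.le hd)
  intro m n
  constructor
  · have h := norm_coupling_le hR (quadWeight_pos m).le
      (quadWeight_pos (m + n)).le (norm_rowWave_le hx hQ hd m n)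
      (norm_columnWave_le hy hQ hd m n) (norm_diagWave_le hz hQ hd m n)
      (norm_diagWaveLeft_le hz hQ hd m n)
    refine h.trans ?_
    have h1 := mul_nonneg (sq_nonneg (r + waveConst * d)) (interactionWeight_nonneg m n)
    change (r + waveConst * d) ^ 2 * W m n ≤ _
    linarith
  · have hc := norm_diagWave_le hz hQ hd m (n + 1)
    have hc' := norm_diagWaveLeft_le hz hQ hd (m + 1) n
    rw [← add_assoc] at hc
    rw [add_right_comm] at hc'
    have h := norm_coupling_le hR (quadWeight_pos m).le
      (quadWeight_pos (m + n + 1)).le (norm_rowWave_le hx hQ hd (m + 1) n)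
      (norm_columnWave_le hy hQ hd m (n + 1)) hc hc'
    refine h.trans ?_
    have h1 := mul_le_mul_of_nonneg_left (weight_shift_le (m := m) (n := n) rfl rfl rfl)
      (sq_nonneg (r + waveConst * d))
    linarith

/-- The coupling is bilinear, so its Lipschitz constant is proportional to the size of the waves,
hence small for small data. -/
theorem bounded_step_sub {e : ℝ} (hx : ∀ n, ‖x n‖ ≤ r * w n) (hy : ∀ n, ‖y n‖ ≤ r * w n)
    (hz : ∀ n, ‖z n‖ ≤ r * w n) (hr : 0 ≤ r) (hd : 0 ≤ d) (hQ : Bounded d Q)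
    (hQ' : Bounded d Q') (he : 0 ≤ e) (hQQ' : Bounded e (Q - Q')) :
    Bounded (6 * (r + waveConst * d) * (waveConst * e)) (step x y z Q - step x y z Q') := by
  have hR : 0 ≤ r + waveConst * d := add_nonneg hr (mul_nonneg waveConst_pos.le hd)
  have he' : 0 ≤ waveConst * e := mul_nonneg waveConst_pos.le he
  have h0 : ∀ n, ‖(0 : ℤ → ℂ) n‖ ≤ 0 * w n := by simp
  have ea : ∀ m n, ‖rowWave x Q m n - rowWave x Q' m n‖ ≤ waveConst * e * w n := fun m n => by
    simpa [rowWave_sub] using norm_rowWave_le h0 hQQ' he m n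
  have eb : ∀ m n, ‖columnWave y Q m n - columnWave y Q' m n‖ ≤ waveConst * e * w m :=
    fun m n => by simpa [columnWave_sub] using norm_columnWave_le h0 hQQ' he m n
  have ec : ∀ m n, ‖diagWave z Q m n - diagWave z Q' m n‖ ≤ waveConst * e * w (m + n) :=
    fun m n => by simpa [diagWave_sub] using norm_diagWave_le h0 hQQ' he m n
  have ec' : ∀ m n, ‖diagWaveLeft z Q m n - diagWaveLeft z Q' m n‖
      ≤ waveConst * e * w (m + n) :=
    fun m n => by simpa [diagWaveLeft_sub] using norm_diagWaveLeft_le h0 hQQ' he m n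
  have hRe := mul_nonneg hR he'
  intro m n
  constructor
  · have h := norm_coupling_sub_le (norm_rowWave_le hx hQ hd m n)
      (norm_diagWaveLeft_le hz hQ hd m n) (norm_columnWave_le hy hQ' hd m n)
      (norm_diagWave_le hz hQ' hd m n) (ea m n) (eb m n) (ec m n) (ec' m n)
    refine h.trans ?_
    have h1 := mul_nonneg hRe (interactionWeight_nonneg m n)
    change 2 * (r + waveConst * d) * (waveConst * e) * W m n ≤ _
    linarith
  · have hc := norm_diagWave_le hz hQ' hd m (n + 1)
    have hc' := norm_diagWaveLeft_le hz hQ hd (m + 1) n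
    have ec1 := ec m (n + 1)
    have ec2 := ec' (m + 1) n
    rw [← add_assoc] at hc ec1
    rw [add_right_comm] at hc' ec2
    have h := norm_coupling_sub_le (norm_rowWave_le hx hQ hd (m + 1) n) hc'
      (norm_columnWave_le hy hQ' hd m (n + 1)) hc (ea (m + 1) n) (eb m (n + 1)) ec1 ec2
    refine h.trans ?_
    have h1 := mul_le_mul_of_nonneg_left (weight_shift_le (m := m) (n := n) rfl rfl rfl) hRe
    linarith

theorem bounded_zero (hd : 0 ≤ d) : Bounded d 0 := fun m n => by
  simpa using mul_nonneg hd (interactionWeight_nonneg m n)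

/-- Iterated interaction terms for data of size `t`. -/
noncomputable def iter (x y z : ℤ → ℂ) (t : ℂ) (j : ℕ) : Interaction :=
  (step (t • x) (t • y) (t • z))^[j] 0

theorem iter_succ (x y z : ℤ → ℂ) (t : ℂ) (j : ℕ) :
    iter x y z t (j + 1) = step (t • x) (t • y) (t • z) (iter x y z t j) :=
  Function.iterate_succ_apply' _ _ _

/-- The size of the data for which the iteration is a contraction. -/
noncomputable def dataRadius : ℝ := 1 / (24 * waveConst)

theorem dataRadius_pos : 0 < dataRadius := by
  have := waveConst_pos
  unfold dataRadius; positivity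

theorem norm_smul_data_le {x : ℤ → ℂ} (hx : ∀ n, ‖x n‖ ≤ w n) (t : ℂ) (n : ℤ) :
    ‖(t • x) n‖ ≤ ‖t‖ * w n := by
  rw [Pi.smul_apply, norm_smul]
  exact mul_le_mul_of_nonneg_left (hx n) (norm_nonneg t)

section Convergence

variable {t : ℂ}

/-- With `d = 12 * ‖t‖ ^ 2` the feedback of the interaction at most doubles the waves. The ball of
this radius is then invariant because `3 * (2 * ‖t‖) ^ 2 = 12 * ‖t‖ ^ 2`. -/
theorem add_waveConst_le (ht : ‖t‖ ≤ dataRadius) :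
    ‖t‖ + waveConst * (12 * ‖t‖ ^ 2) ≤ 2 * ‖t‖ := by
  have hC := waveConst_pos
  have h1 : ‖t‖ * (24 * waveConst) ≤ 1 := by
    rwa [dataRadius, le_div_iff₀ (by positivity)] at ht
  nlinarith [mul_le_mul_of_nonneg_left h1 (norm_nonneg t), norm_nonneg t]

theorem bounded_mono {d' : ℝ} (h : d ≤ d') (hQ : Bounded d Q) : Bounded d' Q := fun m n =>
  have h1 := mul_le_mul_of_nonneg_right h (interactionWeight_nonneg m n)
  ⟨(hQ m n).1.trans h1, (hQ m n).2.trans h1⟩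

theorem bounded_iter (hx : ∀ n, ‖x n‖ ≤ w n) (hy : ∀ n, ‖y n‖ ≤ w n) (hz : ∀ n, ‖z n‖ ≤ w n)
    (ht : ‖t‖ ≤ dataRadius) (j : ℕ) : Bounded (12 * ‖t‖ ^ 2) (iter x y z t j) := by
  induction j with
  | zero => exact bounded_zero (by positivity)
  | succ j ih =>
    rw [iter_succ]
    refine bounded_mono ?_ (bounded_step (norm_smul_data_le hx t) (norm_smul_data_le hy t)
      (norm_smul_data_le hz t) (norm_nonneg t) (by positivity) ih)
    have h := add_waveConst_le ht
    have h0 : 0 ≤ ‖t‖ + waveConst * (12 * ‖t‖ ^ 2) := by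
      have := waveConst_pos
      positivity
    nlinarith [pow_le_pow_left₀ h0 h 2]

theorem bounded_iter_sub (hx : ∀ n, ‖x n‖ ≤ w n) (hy : ∀ n, ‖y n‖ ≤ w n)
    (hz : ∀ n, ‖z n‖ ≤ w n) (ht : ‖t‖ ≤ dataRadius) (j : ℕ) :
    Bounded (12 * dataRadius ^ 2 * (1 / 2) ^ j) (iter x y z t (j + 1) - iter x y z t j) := by
  have hC := waveConst_pos
  have hρ := dataRadius_pos
  induction j with
  | zero =>
    have h := bounded_iter hx hy hz ht 1
    rw [show iter x y z t 0 = 0 from rfl, sub_zero]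
    exact bounded_mono (by nlinarith [pow_le_pow_left₀ (norm_nonneg t) ht 2]) h
  | succ j ih =>
    have h := bounded_step_sub (norm_smul_data_le hx t) (norm_smul_data_le hy t)
      (norm_smul_data_le hz t) (norm_nonneg t) (by positivity) (bounded_iter hx hy hz ht (j + 1))
      (bounded_iter hx hy hz ht j) (by positivity) ih
    rw [← iter_succ, ← iter_succ] at h
    refine bounded_mono ?_ h
    set e := 12 * dataRadius ^ 2 * (1 / 2) ^ j
    have he : 0 ≤ e := by positivity
    have h1 := (add_waveConst_le ht).trans (mul_le_mul_of_nonneg_left ht zero_le_two)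
    have h2 : dataRadius * waveConst = 1 / 24 := by
      unfold dataRadius; field_simp
    -- The contraction factor is `12 * dataRadius * waveConst = 1 / 2`, by the choice of
    -- `dataRadius`.
    calc 6 * (‖t‖ + waveConst * (12 * ‖t‖ ^ 2)) * (waveConst * e)
        ≤ 6 * (2 * dataRadius) * (waveConst * e) := by gcongr
      _ = 12 * (dataRadius * waveConst) * e := by ring
      _ = e * (1 / 2) := by rw [h2]; ring
      _ = 12 * dataRadius ^ 2 * (1 / 2) ^ (j + 1) := by rw [pow_succ]; ring
      _ ≤ _ := le_rfl

end Convergence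

end Interaction

end

/-! ### The solution: existence, holomorphic dependence, reality -/

section

local notation "w" => quadWeight
local notation "W" => interactionWeight

namespace Interaction

open Filter Topology

variable {x y z : ℤ → ℂ} {Q : Interaction}

/-- The limit of the iteration. -/
noncomputable def limit (x y z : ℤ → ℂ) (t : ℂ) : Interaction :=
  (fun m n => ∑' j, ((iter x y z t (j + 1)).1 m n - (iter x y z t j).1 m n),
    fun m n => ∑' j, ((iter x y z t (j + 1)).2 m n - (iter x y z t j).2 m n))

theorem summable_geometric_bound (m n : ℤ) :
    Summable fun j : ℕ => 12 * dataRadius ^ 2 * (1 / 2) ^ j * W m n :=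
  (summable_geometric_two.mul_left _).mul_right _

section Limit

theorem tendsto_iter_fst (hx : ∀ n, ‖x n‖ ≤ w n) (hy : ∀ n, ‖y n‖ ≤ w n)
    (hz : ∀ n, ‖z n‖ ≤ w n) {t : ℂ} (ht : ‖t‖ ≤ dataRadius) (m n : ℤ) :
    Tendsto (fun j => (iter x y z t j).1 m n) atTop (𝓝 ((limit x y z t).1 m n)) := by
  have hs : Summable fun j => (iter x y z t (j + 1)).1 m n - (iter x y z t j).1 m n :=
    (summable_geometric_bound m n).of_norm_bounded fun j =>
      (bounded_iter_sub hx hy hz ht j m n).1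
  have h := hs.hasSum.tendsto_sum_nat
  simp only [Finset.sum_range_sub fun j => (iter x y z t j).1 m n] at h
  rw [show (iter x y z t 0).1 m n = 0 from rfl] at h
  simp only [sub_zero] at h
  exact h

theorem tendsto_iter_snd (hx : ∀ n, ‖x n‖ ≤ w n) (hy : ∀ n, ‖y n‖ ≤ w n)
    (hz : ∀ n, ‖z n‖ ≤ w n) {t : ℂ} (ht : ‖t‖ ≤ dataRadius) (m n : ℤ) :
    Tendsto (fun j => (iter x y z t j).2 m n) atTop (𝓝 ((limit x y z t).2 m n)) := by
  have hs : Summable fun j => (iter x y z t (j + 1)).2 m n - (iter x y z t j).2 m n :=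
    (summable_geometric_bound m n).of_norm_bounded fun j =>
      (bounded_iter_sub hx hy hz ht j m n).2
  have h := hs.hasSum.tendsto_sum_nat
  simp only [Finset.sum_range_sub fun j => (iter x y z t j).2 m n] at h
  rw [show (iter x y z t 0).2 m n = 0 from rfl] at h
  simp only [sub_zero] at h
  exact h

theorem bounded_limit (hx : ∀ n, ‖x n‖ ≤ w n) (hy : ∀ n, ‖y n‖ ≤ w n)
    (hz : ∀ n, ‖z n‖ ≤ w n) {t : ℂ} (ht : ‖t‖ ≤ dataRadius) :
    Bounded (12 * ‖t‖ ^ 2) (limit x y z t) := fun m n =>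
  ⟨le_of_tendsto (tendsto_iter_fst hx hy hz ht m n).norm
      (Eventually.of_forall fun j => (bounded_iter hx hy hz ht j m n).1),
    le_of_tendsto (tendsto_iter_snd hx hy hz ht m n).norm
      (Eventually.of_forall fun j => (bounded_iter hx hy hz ht j m n).2)⟩

end Limit

section Continuity

variable {q : ℕ → Interaction}

theorem tendsto_rowWave
    (h1 : ∀ m n, Tendsto (fun j => (q j).1 m n) atTop (𝓝 (Q.1 m n)))
    (h2 : ∀ m n, Tendsto (fun j => (q j).2 m n) atTop (𝓝 (Q.2 m n)))
    (m n : ℤ) :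
    Tendsto (fun j => rowWave x (q j) m n) atTop (𝓝 (rowWave x Q m n)) :=
  (tendsto_intPrimitive (fun i => (h2 i n).sub (h1 i n)) m).const_add _

theorem tendsto_columnWave
    (h1 : ∀ m n, Tendsto (fun j => (q j).1 m n) atTop (𝓝 (Q.1 m n)))
    (h2 : ∀ m n, Tendsto (fun j => (q j).2 m n) atTop (𝓝 (Q.2 m n)))
    (m n : ℤ) :
    Tendsto (fun j => columnWave y (q j) m n) atTop (𝓝 (columnWave y Q m n)) :=
  (tendsto_intPrimitive (fun i => (h2 m i).sub (h1 m i)) n).const_add _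

theorem tendsto_diagWave
    (h1 : ∀ m n, Tendsto (fun j => (q j).1 m n) atTop (𝓝 (Q.1 m n)))
    (h2 : ∀ m n, Tendsto (fun j => (q j).2 m n) atTop (𝓝 (Q.2 m n)))
    (m n : ℤ) :
    Tendsto (fun j => diagWave z (q j) m n) atTop (𝓝 (diagWave z Q m n)) :=
  (tendsto_intPrimitive (fun i => (h2 _ i).sub (h1 _ i)) n).const_add _

theorem tendsto_diagWaveLeft
    (h1 : ∀ m n, Tendsto (fun j => (q j).1 m n) atTop (𝓝 (Q.1 m n)))
    (h2 : ∀ m n, Tendsto (fun j => (q j).2 m n) atTop (𝓝 (Q.2 m n)))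
    (m n : ℤ) :
    Tendsto (fun j => diagWaveLeft z (q j) m n) atTop (𝓝 (diagWaveLeft z Q m n)) :=
  (tendsto_diagWave h1 h2 m n).sub (h1 m n)

theorem tendsto_coupling {a b c c' : ℕ → ℂ} {a₀ b₀ c₀ c₀' : ℂ} (ha : Tendsto a atTop (𝓝 a₀))
    (hb : Tendsto b atTop (𝓝 b₀)) (hc : Tendsto c atTop (𝓝 c₀)) (hc' : Tendsto c' atTop (𝓝 c₀')) :
    Tendsto (fun j => coupling (a j) (b j) (c j) (c' j)) atTop (𝓝 (coupling a₀ b₀ c₀ c₀')) :=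
  ((hb.mul ha).add (hb.mul hc')).sub (hc.mul ha)

end Continuity

/-- Each entry of `step` involves finitely many entries of `Q`, so pointwise convergence of the
iterates is enough to pass to the limit in the recursion. -/
theorem step_limit (hx : ∀ n, ‖x n‖ ≤ w n) (hy : ∀ n, ‖y n‖ ≤ w n) (hz : ∀ n, ‖z n‖ ≤ w n)
    {t : ℂ} (ht : ‖t‖ ≤ dataRadius) :
    step (t • x) (t • y) (t • z) (limit x y z t) = limit x y z t := by
  have h1 := tendsto_iter_fst hx hy hz ht
  have h2 := tendsto_iter_snd hx hy hz ht
  refine Prod.ext (funext fun m => funext fun n => ?_) (funext fun m => funext fun n => ?_)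
  · refine tendsto_nhds_unique ?_ ((h1 m n).comp (tendsto_add_atTop_nat 1))
    simp only [Function.comp_def, iter_succ]
    exact tendsto_coupling (tendsto_rowWave h1 h2 _ _) (tendsto_columnWave h1 h2 _ _)
      (tendsto_diagWave h1 h2 _ _) (tendsto_diagWaveLeft h1 h2 _ _)
  · refine tendsto_nhds_unique ?_ ((h2 m n).comp (tendsto_add_atTop_nat 1))
    simp only [Function.comp_def, iter_succ]
    exact tendsto_coupling (tendsto_rowWave h1 h2 _ _) (tendsto_columnWave h1 h2 _ _)
      (tendsto_diagWave h1 h2 _ _) (tendsto_diagWaveLeft h1 h2 _ _)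

section Differentiability

variable {s : Set ℂ} {q : ℂ → Interaction}

theorem differentiableOn_rowWave
    (h1 : ∀ m n, DifferentiableOn ℂ (fun t => (q t).1 m n) s)
    (h2 : ∀ m n, DifferentiableOn ℂ (fun t => (q t).2 m n) s)
    (m n : ℤ) :
    DifferentiableOn ℂ (fun t => rowWave (t • x) (q t) m n) s := by
  simp only [rowWave, intPrimitive, Pi.smul_apply, smul_eq_mul]
  fun_prop

theorem differentiableOn_columnWave
    (h1 : ∀ m n, DifferentiableOn ℂ (fun t => (q t).1 m n) s)
    (h2 : ∀ m n, DifferentiableOn ℂ (fun t => (q t).2 m n) s)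
    (m n : ℤ) :
    DifferentiableOn ℂ (fun t => columnWave (t • y) (q t) m n) s := by
  simp only [columnWave, intPrimitive, Pi.smul_apply, smul_eq_mul]
  fun_prop

theorem differentiableOn_diagWave
    (h1 : ∀ m n, DifferentiableOn ℂ (fun t => (q t).1 m n) s)
    (h2 : ∀ m n, DifferentiableOn ℂ (fun t => (q t).2 m n) s)
    (m n : ℤ) :
    DifferentiableOn ℂ (fun t => diagWave (t • z) (q t) m n) s := by
  simp only [diagWave, intPrimitive, Pi.smul_apply, smul_eq_mul]
  fun_prop

theorem differentiableOn_diagWaveLeft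
    (h1 : ∀ m n, DifferentiableOn ℂ (fun t => (q t).1 m n) s)
    (h2 : ∀ m n, DifferentiableOn ℂ (fun t => (q t).2 m n) s)
    (m n : ℤ) :
    DifferentiableOn ℂ (fun t => diagWaveLeft (t • z) (q t) m n) s :=
  (differentiableOn_diagWave h1 h2 m n).sub (h1 m n)

theorem differentiableOn_step
    (h1 : ∀ m n, DifferentiableOn ℂ (fun t => (q t).1 m n) s)
    (h2 : ∀ m n, DifferentiableOn ℂ (fun t => (q t).2 m n) s)
    (m n : ℤ) :
    DifferentiableOn ℂ (fun t => (step (t • x) (t • y) (t • z) (q t)).1 m n) s ∧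
      DifferentiableOn ℂ (fun t => (step (t • x) (t • y) (t • z) (q t)).2 m n) s := by
  have ha := differentiableOn_rowWave (x := x) h1 h2
  have hb := differentiableOn_columnWave (y := y) h1 h2
  have hc := differentiableOn_diagWave (z := z) h1 h2
  have hc' := differentiableOn_diagWaveLeft (z := z) h1 h2
  simp only [step, coupling]
  constructor <;> fun_prop

end Differentiability

theorem differentiableOn_iter (s : Set ℂ) (j : ℕ) :
    ∀ m n, DifferentiableOn ℂ (fun t => (iter x y z t j).1 m n) s ∧
      DifferentiableOn ℂ (fun t => (iter x y z t j).2 m n) s := by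
  induction j with
  | zero => intro m n; simp [iter]
  | succ j ih =>
    intro m n
    simp only [iter_succ]
    exact differentiableOn_step (fun m n => (ih m n).1) (fun m n => (ih m n).2) m n

/-- Each iterate is polynomial in `t`, and the telescoping series defining `limit` has a geometric
majorant independent of `t`, so the Weierstrass theorem applies. -/
theorem differentiableOn_limit (hx : ∀ n, ‖x n‖ ≤ w n) (hy : ∀ n, ‖y n‖ ≤ w n)
    (hz : ∀ n, ‖z n‖ ≤ w n) (m n : ℤ) :
    DifferentiableOn ℂ (fun t => (limit x y z t).1 m n) (Metric.ball 0 dataRadius) ∧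
      DifferentiableOn ℂ (fun t => (limit x y z t).2 m n) (Metric.ball 0 dataRadius) := by
  have ht : ∀ t ∈ Metric.ball (0 : ℂ) dataRadius, ‖t‖ ≤ dataRadius := fun t ht =>
    (mem_ball_zero_iff.mp ht).le
  constructor
  · exact Complex.differentiableOn_tsum_of_summable_norm (summable_geometric_bound m n)
      (fun j => (differentiableOn_iter _ (j + 1) m n).1.sub (differentiableOn_iter _ j m n).1)
      Metric.isOpen_ball fun j t h => (bounded_iter_sub hx hy hz (ht t h) j m n).1
  · exact Complex.differentiableOn_tsum_of_summable_norm (summable_geometric_bound m n)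
      (fun j => (differentiableOn_iter _ (j + 1) m n).2.sub (differentiableOn_iter _ j m n).2)
      Metric.isOpen_ball fun j t h => (bounded_iter_sub hx hy hz (ht t h) j m n).2

/-- All interaction terms are real. -/
def IsReal (Q : Interaction) : Prop := ∀ m n, (Q.1 m n).im = 0 ∧ (Q.2 m n).im = 0

section Real

theorem im_rowWave (hx : ∀ n, (x n).im = 0) (hQ : IsReal Q) (m n : ℤ) :
    (rowWave x Q m n).im = 0 := by
  have := im_intPrimitive_eq_zero (f := fun i => Q.2 i n - Q.1 i n) (by simp [hQ _ _]) m
  simp [rowWave, hx, this]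

theorem im_columnWave (hy : ∀ n, (y n).im = 0) (hQ : IsReal Q) (m n : ℤ) :
    (columnWave y Q m n).im = 0 := by
  have := im_intPrimitive_eq_zero (f := fun i => Q.2 m i - Q.1 m i) (by simp [hQ _ _]) n
  simp [columnWave, hy, this]

theorem im_diagWave (hz : ∀ n, (z n).im = 0) (hQ : IsReal Q) (m n : ℤ) :
    (diagWave z Q m n).im = 0 := by
  have := im_intPrimitive_eq_zero (f := fun j => Q.2 (m + n - j - 1) j - Q.1 (m + n - j) j)
    (by simp [hQ _ _]) n
  simp [diagWave, hz, this]

theorem im_diagWaveLeft (hz : ∀ n, (z n).im = 0) (hQ : IsReal Q) (m n : ℤ) :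
    (diagWaveLeft z Q m n).im = 0 := by
  simp [diagWaveLeft, im_diagWave hz hQ, hQ _ _]

theorem isReal_iter (hx : ∀ n, (x n).im = 0) (hy : ∀ n, (y n).im = 0) (hz : ∀ n, (z n).im = 0)
    {t : ℂ} (ht : t.im = 0) (j : ℕ) : IsReal (iter x y z t j) := by
  have hs : ∀ {v : ℤ → ℂ}, (∀ n, (v n).im = 0) → ∀ n, ((t • v) n).im = 0 := fun hv n => by
    simp [ht, hv]
  induction j with
  | zero => intro m n; simp [iter]
  | succ j ih =>
    have ha := im_rowWave (hs hx) ih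
    have hb := im_columnWave (hs hy) ih
    have hc := im_diagWave (hs hz) ih
    have hc' := im_diagWaveLeft (hs hz) ih
    intro m n
    rw [iter_succ]
    simp [step, coupling, ha, hb, hc, hc']

theorem isReal_limit (hx : ∀ n, (x n).im = 0) (hy : ∀ n, (y n).im = 0) (hz : ∀ n, (z n).im = 0)
    (hx' : ∀ n, ‖x n‖ ≤ w n) (hy' : ∀ n, ‖y n‖ ≤ w n) (hz' : ∀ n, ‖z n‖ ≤ w n)
    {t : ℂ} (ht : t.im = 0) (ht' : ‖t‖ ≤ dataRadius) : IsReal (limit x y z t) := fun m n => by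
  have h := isReal_iter hx hy hz ht
  have c := Complex.continuous_im.tendsto
  constructor
  · refine tendsto_nhds_unique ((c _).comp (tendsto_iter_fst hx' hy' hz' ht' m n)) ?_
    simp [Function.comp_def, h _ m n]
  · refine tendsto_nhds_unique ((c _).comp (tendsto_iter_snd hx' hy' hz' ht' m n)) ?_
    simp [Function.comp_def, h _ m n]

end Real

/-- With `d` of order `‖t‖ ^ 2`, this and its analogues say that the waves agree with their data to
first order in `t`. -/
theorem norm_rowWave_sub_le {d : ℝ} (hQ : Bounded d Q) (hd : 0 ≤ d) (m n : ℤ) :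
    ‖rowWave x Q m n - x n‖ ≤ waveConst * d * w n := by
  have h0 : ∀ n, ‖(0 : ℤ → ℂ) n‖ ≤ 0 * w n := by simp
  simpa [rowWave] using norm_rowWave_le h0 hQ hd m n

theorem norm_columnWave_sub_le {d : ℝ} (hQ : Bounded d Q) (hd : 0 ≤ d) (m n : ℤ) :
    ‖columnWave y Q m n - y m‖ ≤ waveConst * d * w m := by
  have h0 : ∀ n, ‖(0 : ℤ → ℂ) n‖ ≤ 0 * w n := by simp
  simpa [columnWave] using norm_columnWave_le h0 hQ hd m n

theorem norm_diagWave_sub_le {d : ℝ} (hQ : Bounded d Q) (hd : 0 ≤ d) (m n : ℤ) :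
    ‖diagWave z Q m n - z (m + n)‖ ≤ waveConst * d * w (m + n) := by
  have h0 : ∀ n, ‖(0 : ℤ → ℂ) n‖ ≤ 0 * w n := by simp
  simpa [diagWave] using norm_diagWave_le h0 hQ hd m n

theorem norm_diagWaveLeft_sub_le {d : ℝ} (hQ : Bounded d Q) (hd : 0 ≤ d) (m n : ℤ) :
    ‖diagWaveLeft z Q m n - z (m + n)‖ ≤ waveConst * d * w (m + n) := by
  have h0 : ∀ n, ‖(0 : ℤ → ℂ) n‖ ≤ 0 * w n := by simp
  have h := norm_diagWaveLeft_le h0 hQ hd m n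
  have e : diagWaveLeft z Q m n - z (m + n) = diagWaveLeft 0 Q m n := by
    simp only [diagWaveLeft, diagWave, Pi.zero_apply]; ring
  rw [e]
  simpa using h

theorem rowWave_add_one (m n : ℤ) :
    rowWave x Q (m + 1) n - rowWave x Q m n = Q.2 m n - Q.1 m n := by
  simp only [rowWave, intPrimitive_add_one]; ring

theorem columnWave_add_one (m n : ℤ) :
    columnWave y Q m (n + 1) - columnWave y Q m n = Q.2 m n - Q.1 m n := by
  simp only [columnWave, intPrimitive_add_one]; ring

theorem diagWave_add_one (m n : ℤ) :
    diagWave z Q m (n + 1) - diagWaveLeft z Q (m + 1) n = Q.2 m n := by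
  simp only [diagWaveLeft, diagWave, intPrimitive_add_one,
    show m + 1 + n = m + (n + 1) by ring,
    show m + (n + 1) - n = m + 1 by ring, add_sub_cancel_right]
  ring

end Interaction

end

/-! ### Genericity: transcendental data, isolated zeros, leading coefficients -/

section

open Filter Topology

section Transcendental

/-- Every nonempty open interval meets the complement of a countable set. -/
theorem exists_mem_Ioo_notMem_of_countable {S : Set ℝ} (hS : S.Countable) {a b : ℝ} (hab : a < b) :
    ∃ t ∈ Set.Ioo a b, t ∉ S := by
  obtain ⟨t, h1, h2⟩ := (hS.dense_compl ℝ).exists_mem_open isOpen_Ioo (Set.nonempty_Ioo.mpr hab)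
  exact ⟨t, h2, h1⟩

theorem exists_transcendental_mem_Ioo {a b : ℝ} (hab : a < b) :
    ∃ θ ∈ Set.Ioo a b, Transcendental ℤ θ :=
  exists_mem_Ioo_notMem_of_countable (Algebraic.countable ℤ ℝ) hab

/-- Powers of four have no nontrivial three-term arithmetic progression. -/
theorem four_pow_add_ne {a b l : ℕ} (hab : a < b) : 4 ^ a + 4 ^ b ≠ 2 * 4 ^ l := by
  rcases lt_or_ge l b with h | h
  · have h1 : 4 ^ (l + 1) ≤ 4 ^ b := Nat.pow_le_pow_right (by norm_num) h
    have h2 : 0 < 4 ^ a := by positivity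
    rw [pow_succ] at h1
    omega
  · have h1 : 4 ^ b ≤ 4 ^ l := Nat.pow_le_pow_right (by norm_num) h
    have h2 : 4 ^ (a + 1) ≤ 4 ^ l := Nat.pow_le_pow_right (by norm_num) (by omega)
    have h3 : 0 < 4 ^ a := by positivity
    rw [pow_succ] at h2
    omega

open Polynomial in
/-- A polynomial whose values record a three-element set of exponents. -/
noncomputable def triplePoly (a b c : ℕ) : ℤ[X] :=
  X ^ (2 * 4 ^ a) + X ^ (2 * 4 ^ b) + X ^ (2 * 4 ^ c)
    - X ^ (4 ^ a + 4 ^ b) - X ^ (4 ^ b + 4 ^ c) - X ^ (4 ^ a + 4 ^ c)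

/-- By `four_pow_add_ne` no mixed exponent `4 ^ p + 4 ^ q` with `p ≠ q` equals some `2 * 4 ^ l`, so
nothing cancels the square terms and the set of indices can be read off. -/
theorem coeff_triplePoly {a b c : ℕ} (hab : a ≠ b) (hbc : b ≠ c) (hac : a ≠ c) (l : ℕ) :
    (triplePoly a b c).coeff (2 * 4 ^ l) = if l = a ∨ l = b ∨ l = c then 1 else 0 := by
  have key : ∀ {p q : ℕ}, p ≠ q → 2 * 4 ^ l ≠ 4 ^ p + 4 ^ q := fun {p q} h => by
    rcases lt_or_gt_of_ne h with h | h
    · exact (four_pow_add_ne h).symm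
    · rw [add_comm]; exact (four_pow_add_ne h).symm
  have inj : ∀ p : ℕ, 2 * 4 ^ l = 2 * 4 ^ p ↔ l = p := fun p =>
    ⟨fun h => Nat.pow_right_injective (le_refl 4 |>.trans' (by norm_num))
      (Nat.eq_of_mul_eq_mul_left two_pos h), fun h => by rw [h]⟩
  simp only [triplePoly, Polynomial.coeff_sub, Polynomial.coeff_add, Polynomial.coeff_X_pow, inj,
    key hab, key hbc, key hac, if_false, sub_zero]
  split_ifs <;> simp_all

theorem triplePoly_inj {a b c a' b' c' : ℕ} (hab : a ≠ b) (hbc : b ≠ c) (hac : a ≠ c)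
    (hab' : a' ≠ b') (hbc' : b' ≠ c') (hac' : a' ≠ c')
    (h : triplePoly a b c = triplePoly a' b' c') (l : ℕ) :
    (l = a ∨ l = b ∨ l = c) ↔ (l = a' ∨ l = b' ∨ l = c') := by
  have h1 := coeff_triplePoly hab hbc hac l
  rw [h, coeff_triplePoly hab' hbc' hac'] at h1
  split_ifs at h1 <;> simp_all

theorem triplePoly_ne_zero {a b c : ℕ} (hab : a ≠ b) (hbc : b ≠ c) (hac : a ≠ c) :
    triplePoly a b c ≠ 0 := fun h => by
  have h1 := coeff_triplePoly hab hbc hac a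
  simp [h] at h1

end Transcendental

/-- An injective numbering of the integers. -/
def intCode (n : ℤ) : ℕ := if 0 ≤ n then 2 * n.toNat else 2 * (-n).toNat + 1

theorem intCode_injective : Function.Injective intCode := fun m n h => by
  unfold intCode at h
  split_ifs at h <;> omega

theorem natAbs_le_intCode (n : ℤ) : n.natAbs ≤ intCode n := by
  unfold intCode
  split_ifs <;> omega

theorem pow_four_pow_le_quadWeight {θ : ℝ} (h0 : 0 < θ) (h1 : θ < 1 / 2) {n : ℤ} {j : ℕ}
    (hj : n.natAbs ≤ j) : θ ^ 4 ^ j ≤ quadWeight n := by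
  have hn : ((n.natAbs : ℕ) : ℝ) ^ 2 = (n : ℝ) ^ 2 := by
    rw [Nat.cast_natAbs, Int.cast_abs, sq_abs]
  have h3 : ∀ k : ℕ, 1 + k ^ 2 ≤ 4 ^ k := fun k => by
    induction k with
    | zero => norm_num
    | succ k ih => rw [pow_succ 4]; nlinarith
  have h4 : 1 + (n : ℝ) ^ 2 ≤ 2 ^ 4 ^ j := by
    rw [← hn]
    have h5 : 1 + n.natAbs ^ 2 ≤ 2 ^ 4 ^ j :=
      ((h3 _).trans (Nat.pow_le_pow_right (by norm_num) hj)).trans Nat.lt_two_pow_self.le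
    exact_mod_cast h5
  calc θ ^ 4 ^ j ≤ (1 / 2) ^ 4 ^ j := by gcongr
    _ = 1 / 2 ^ 4 ^ j := by rw [one_div_pow]
    _ ≤ quadWeight n := one_div_le_one_div_of_le (by positivity) h4

/-- The zeros of a nonzero holomorphic function on a ball are countable. -/
theorem countable_zeros_of_differentiableOn {f : ℂ → ℂ} {r : ℝ}
    (hf : DifferentiableOn ℂ f (Metric.ball 0 r)) (hne : ¬ Set.EqOn f 0 (Metric.ball 0 r)) :
    {t ∈ Metric.ball (0 : ℂ) r | f t = 0}.Countable := by
  have ha : AnalyticOnNhd ℂ f (Metric.ball 0 r) := hf.analyticOnNhd Metric.isOpen_ball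
  have hU : IsPreconnected (Metric.ball (0 : ℂ) r) := (convex_ball 0 r).isPreconnected
  refine (HereditarilyLindelofSpace.isLindelof _).countable_of_isDiscrete ?_
  refine ⟨?_⟩
  rw [discreteTopology_subtype_iff]
  rintro t ⟨ht, -⟩
  by_contra hbot
  refine hne (ha.eqOn_zero_of_preconnected_of_frequently_eq_zero hU ht ?_)
  rw [← ne_eq, ← neBot_iff] at hbot
  rw [frequently_iff_neBot]
  exact hbot.mono (inf_le_inf_left _ (principal_mono.mpr fun s hs => hs.2))

/-- The quadratic form of the triangular lattice. -/
def hexForm {R : Type*} [CommRing R] (u v : R) : R := u ^ 2 + u * v + v ^ 2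

/-- The deviation from equilaterality of the triangle spanned by `(1 + c, b - c)` and
`(a + c', 1 - c')`. -/
def shapeDefect {R : Type*} [CommRing R] (a b c c' : R) : R :=
  (hexForm (1 + c) (b - c) - 1) ^ 2 + (hexForm (a + c') (1 - c') - 1) ^ 2
    + (hexForm (a + c' - (1 + c)) (1 - c' - (b - c)) - 1) ^ 2

/-- The limit of `shapeDefect` under scaling. -/
theorem tendsto_shapeDefect_div {a b c c' : ℂ → ℂ} {X Y Z : ℂ}
    (ha : Tendsto (fun t => a t / t) (𝓝[≠] 0) (𝓝 X))
    (hb : Tendsto (fun t => b t / t) (𝓝[≠] 0) (𝓝 Y))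
    (hc : Tendsto (fun t => c t / t) (𝓝[≠] 0) (𝓝 Z))
    (hc' : Tendsto (fun t => c' t / t) (𝓝[≠] 0) (𝓝 Z)) :
    Tendsto (fun t => shapeDefect (a t) (b t) (c t) (c' t) / t ^ 2) (𝓝[≠] 0)
      (𝓝 ((Y + Z) ^ 2 + (X - Z) ^ 2 + (X + Y) ^ 2)) := by
  have hid : Tendsto (fun t : ℂ => t) (𝓝[≠] 0) (𝓝 0) := tendsto_nhdsWithin_of_tendsto_nhds tendsto_id
  have key : Continuous fun p : ℂ × ℂ × ℂ × ℂ × ℂ =>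
      -- Here `p` stands for `(t, b / t, c / t, a / t, c' / t)`. Each squared side deviation,
      -- divided by `t ^ 2`, is the square of a linear form plus `t` times a quadratic form in the
      -- rescaled waves; only the linear forms survive at `t = 0`.
      (p.2.1 + p.2.2.1 + p.1 * (p.2.1 ^ 2 - p.2.1 * p.2.2.1 + p.2.2.1 ^ 2)) ^ 2
      + (p.2.2.2.1 - p.2.2.2.2
        + p.1 * (p.2.2.2.1 ^ 2 + p.2.2.2.1 * p.2.2.2.2 + p.2.2.2.2 ^ 2)) ^ 2
      + (-(p.2.2.2.1 + p.2.2.2.2 - p.2.2.1) - (p.2.1 + p.2.2.2.2 - p.2.2.1) + p.1 * hexForm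
        (p.2.2.2.1 + p.2.2.2.2 - p.2.2.1) (p.2.2.1 - p.2.1 - p.2.2.2.2)) ^ 2 := by
    unfold hexForm; fun_prop
  have h := (key.tendsto (0, Y, Z, X, Z)).comp
    (hid.prodMk_nhds (hb.prodMk_nhds (hc.prodMk_nhds (ha.prodMk_nhds hc'))))
  have e : (Y + Z) ^ 2 + (X - Z) ^ 2 + (X + Y) ^ 2 =
      (Y + Z + 0 * (Y ^ 2 - Y * Z + Z ^ 2)) ^ 2 + (X - Z + 0 * (X ^ 2 + X * Z + Z ^ 2)) ^ 2
      + (-(X + Z - Z) - (Y + Z - Z) + 0 * hexForm (X + Z - Z) (Z - Y - Z)) ^ 2 := by ring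
  rw [e]
  refine h.congr' ?_
  filter_upwards [self_mem_nhdsWithin] with t ht
  have ht : t ≠ 0 := ht
  simp only [Function.comp_def, shapeDefect, hexForm]
  field_simp
  ring

end

/-! ### Wave fields with distinct nonzero defects -/

section

open Filter Topology

local notation "w" => quadWeight

/-- The indices of the triangles: `(m, n, true)` is upward, `(m, n, false)` is downward. -/
abbrev TileIndex : Type := ℤ × ℤ × Bool

/-- Waves on the edges of the triangular lattice. The edge vectors in lattice coordinates are
`(1 + diag, column - diag)` and `(row + diagLeft, 1 - diagLeft)`. -/
structure WaveField (R : Type*) where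
  row : ℤ → ℤ → R
  column : ℤ → ℤ → R
  diag : ℤ → ℤ → R
  diagLeft : ℤ → ℤ → R

namespace WaveField

variable {R : Type*} [CommRing R]

/-- The equations saying that the edges close up and span triangles of equal area. -/
structure IsSolution (F : WaveField R) : Prop where
  up : ∀ m n, F.diag m n - F.diagLeft m n =
    F.column m n * F.row m n + F.column m n * F.diagLeft m n - F.diag m n * F.row m n
  down : ∀ m n, F.diag m (n + 1) - F.diagLeft (m + 1) n =
    F.column m (n + 1) * F.row (m + 1) n + F.column m (n + 1) * F.diagLeft (m + 1) n
      - F.diag m (n + 1) * F.row (m + 1) n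
  closed_fst : ∀ m n, F.diag m n - F.diagLeft m n + (F.row (m + 1) n - F.row m n) =
    F.diag m (n + 1) - F.diagLeft (m + 1) n
  closed_snd : ∀ m n, F.column m (n + 1) - F.column m n = F.row (m + 1) n - F.row m n

/-- The deviation of a triangle from equilaterality. -/
def tileDefect (F : WaveField R) : TileIndex → R
  | (m, n, true) => shapeDefect (F.row m n) (F.column m n) (F.diag m n) (F.diagLeft m n)
  | (m, n, false) => shapeDefect (F.row (m + 1) n) (F.column m (n + 1)) (F.diag m (n + 1))
      (F.diagLeft (m + 1) n)

/-- The number of the diagonal containing a triangle. -/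
def diagIndex : TileIndex → ℤ
  | (m, n, true) => m + n
  | (m, n, false) => m + n + 1

/-- The upward and downward triangles of one parallelogram share row and column but lie on
consecutive diagonals, so the three waves crossing a triangle identify it. -/
theorem tileIndex_ext {s t : TileIndex} (h1 : s.1 = t.1) (h2 : s.2.1 = t.2.1)
    (h3 : diagIndex s = diagIndex t) : s = t := by
  obtain ⟨m, n, b⟩ := s
  obtain ⟨m', n', b'⟩ := t
  simp only at h1 h2
  subst h1 h2
  cases b <;> cases b' <;> simp_all [diagIndex]

/-- The waves of the interaction obtained from data of size `t`. -/
noncomputable def ofData (x y z : ℤ → ℂ) (t : ℂ) : WaveField ℂ where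
  row := Interaction.rowWave (t • x) (Interaction.limit x y z t)
  column := Interaction.columnWave (t • y) (Interaction.limit x y z t)
  diag := Interaction.diagWave (t • z) (Interaction.limit x y z t)
  diagLeft := Interaction.diagWaveLeft (t • z) (Interaction.limit x y z t)

section OfData

open Interaction

variable {x y z : ℤ → ℂ}

theorem isSolution_ofData (hx : ∀ n, ‖x n‖ ≤ w n) (hy : ∀ n, ‖y n‖ ≤ w n)
    (hz : ∀ n, ‖z n‖ ≤ w n) {t : ℂ} (ht : ‖t‖ ≤ dataRadius) : (ofData x y z t).IsSolution := by
  have h := step_limit hx hy hz ht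
  have h1 := fun m n => congrFun (congrFun (congrArg Prod.fst h) m) n
  have h2 := fun m n => congrFun (congrFun (congrArg Prod.snd h) m) n
  have hd : ∀ m n, (ofData x y z t).diag m n - (ofData x y z t).diagLeft m n
      = (limit x y z t).1 m n := fun m n => sub_sub_cancel _ _
  have hd' : ∀ m n, (ofData x y z t).diag m (n + 1) - (ofData x y z t).diagLeft (m + 1) n
      = (limit x y z t).2 m n := fun m n => diagWave_add_one m n
  have hr : ∀ m n, (ofData x y z t).row (m + 1) n - (ofData x y z t).row m n
      = (limit x y z t).2 m n - (limit x y z t).1 m n := fun m n => rowWave_add_one m n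
  refine ⟨fun m n => (hd m n).trans (h1 m n).symm, fun m n => (hd' m n).trans (h2 m n).symm,
    fun m n => ?_, fun m n => ?_⟩
  · rw [hd, hd', hr]; ring
  · rw [hr]; exact columnWave_add_one m n

theorem norm_ofData_le (hx : ∀ n, ‖x n‖ ≤ w n) (hy : ∀ n, ‖y n‖ ≤ w n)
    (hz : ∀ n, ‖z n‖ ≤ w n) {t : ℂ} (ht : ‖t‖ ≤ dataRadius) (m n : ℤ) :
    ‖(ofData x y z t).row m n‖ ≤ 2 * ‖t‖ * w n ∧ ‖(ofData x y z t).column m n‖ ≤ 2 * ‖t‖ * w m ∧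
    ‖(ofData x y z t).diag m n‖ ≤ 2 * ‖t‖ * w (m + n) ∧
    ‖(ofData x y z t).diagLeft m n‖ ≤ 2 * ‖t‖ * w (m + n) := by
  have hQ := bounded_limit hx hy hz ht
  have hd : 0 ≤ 12 * ‖t‖ ^ 2 := by positivity
  have h2 := fun k => mul_le_mul_of_nonneg_right (add_waveConst_le ht) (quadWeight_pos k).le
  exact ⟨(norm_rowWave_le (norm_smul_data_le hx t) hQ hd m n).trans (h2 _),
    (norm_columnWave_le (norm_smul_data_le hy t) hQ hd m n).trans (h2 _),
    (norm_diagWave_le (norm_smul_data_le hz t) hQ hd m n).trans (h2 _),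
    (norm_diagWaveLeft_le (norm_smul_data_le hz t) hQ hd m n).trans (h2 _)⟩

theorem tendsto_div_of_norm_sub_le {f : ℂ → ℂ} {X : ℂ} {C r : ℝ} (hr : 0 < r)
    (h : ∀ t : ℂ, ‖t‖ ≤ r → ‖f t - t * X‖ ≤ C * ‖t‖ ^ 2) :
    Tendsto (fun t => f t / t) (𝓝[≠] 0) (𝓝 X) := by
  rw [tendsto_iff_norm_sub_tendsto_zero]
  have hlim : Tendsto (fun t : ℂ => C * ‖t‖) (𝓝[≠] 0) (𝓝 0) := by
    have : Tendsto (fun t : ℂ => C * ‖t‖) (𝓝 0) (𝓝 (C * ‖(0 : ℂ)‖)) :=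
      (continuous_const.mul continuous_norm).tendsto 0
    rw [norm_zero, mul_zero] at this
    exact tendsto_nhdsWithin_of_tendsto_nhds this
  refine squeeze_zero' (Eventually.of_forall fun t => norm_nonneg _) ?_ hlim
  filter_upwards [self_mem_nhdsWithin,
    mem_nhdsWithin_of_mem_nhds (Metric.closedBall_mem_nhds (0 : ℂ) hr)] with t ht0 htr
  have ht0 : t ≠ 0 := ht0
  rw [show f t / t - X = (f t - t * X) / t by field_simp, norm_div,
    div_le_iff₀ (norm_pos_iff.mpr ht0)]
  have := h t (mem_closedBall_zero_iff.mp htr)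
  nlinarith

theorem tendsto_ofData_div (hx : ∀ n, ‖x n‖ ≤ w n) (hy : ∀ n, ‖y n‖ ≤ w n)
    (hz : ∀ n, ‖z n‖ ≤ w n) (m n : ℤ) :
    Tendsto (fun t => (ofData x y z t).row m n / t) (𝓝[≠] 0) (𝓝 (x n)) ∧
    Tendsto (fun t => (ofData x y z t).column m n / t) (𝓝[≠] 0) (𝓝 (y m)) ∧
    Tendsto (fun t => (ofData x y z t).diag m n / t) (𝓝[≠] 0) (𝓝 (z (m + n))) ∧
    Tendsto (fun t => (ofData x y z t).diagLeft m n / t) (𝓝[≠] 0) (𝓝 (z (m + n))) := by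
  have hw : ∀ (t : ℂ) (k : ℤ), waveConst * (12 * ‖t‖ ^ 2) * w k ≤ 12 * waveConst * ‖t‖ ^ 2 :=
    fun t k => by
      have h0 : 0 ≤ waveConst * (12 * ‖t‖ ^ 2) := by
        have := waveConst_pos
        positivity
      nlinarith [mul_le_mul_of_nonneg_left (quadWeight_le_one k) h0]
  have hd : ∀ t : ℂ, 0 ≤ 12 * ‖t‖ ^ 2 := fun t => by positivity
  have hQ := fun t ht => bounded_limit hx hy hz (t := t) ht
  refine ⟨?_, ?_, ?_, ?_⟩ <;>
    refine tendsto_div_of_norm_sub_le (C := 12 * waveConst) dataRadius_pos fun t ht => ?_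
  · exact (norm_rowWave_sub_le (x := t • x) (hQ t ht) (hd t) m n).trans (hw t _)
  · exact (norm_columnWave_sub_le (y := t • y) (hQ t ht) (hd t) m n).trans (hw t _)
  · exact (norm_diagWave_sub_le (z := t • z) (hQ t ht) (hd t) m n).trans (hw t _)
  · exact (norm_diagWaveLeft_sub_le (z := t • z) (hQ t ht) (hd t) m n).trans (hw t _)

theorem tendsto_tileDefect_div (hx : ∀ n, ‖x n‖ ≤ w n) (hy : ∀ n, ‖y n‖ ≤ w n)
    (hz : ∀ n, ‖z n‖ ≤ w n) (s : TileIndex) :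
    Tendsto (fun t => tileDefect (ofData x y z t) s / t ^ 2) (𝓝[≠] 0)
      (𝓝 ((y s.1 + z (diagIndex s)) ^ 2 + (x s.2.1 - z (diagIndex s)) ^ 2
        + (x s.2.1 + y s.1) ^ 2)) := by
  have h := tendsto_ofData_div hx hy hz
  obtain ⟨m, n, b⟩ := s
  cases b
  · have h3 := (h m (n + 1)).2.2.1
    have h4 := (h (m + 1) n).2.2.2
    rw [← add_assoc] at h3
    rw [add_right_comm] at h4
    exact tendsto_shapeDefect_div (h (m + 1) n).1 (h m (n + 1)).2.1 h3 h4
  · exact tendsto_shapeDefect_div (h m n).1 (h m n).2.1 (h m n).2.2.1 (h m n).2.2.2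

theorem differentiableOn_tileDefect (hx : ∀ n, ‖x n‖ ≤ w n) (hy : ∀ n, ‖y n‖ ≤ w n)
    (hz : ∀ n, ‖z n‖ ≤ w n) (s : TileIndex) :
    DifferentiableOn ℂ (fun t => tileDefect (ofData x y z t) s) (Metric.ball 0 dataRadius) := by
  have h1 := fun m n => (differentiableOn_limit hx hy hz m n).1
  have h2 := fun m n => (differentiableOn_limit hx hy hz m n).2
  have ha : ∀ m n, DifferentiableOn ℂ (fun t => (ofData x y z t).row m n)
      (Metric.ball 0 dataRadius) := differentiableOn_rowWave h1 h2
  have hb : ∀ m n, DifferentiableOn ℂ (fun t => (ofData x y z t).column m n)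
      (Metric.ball 0 dataRadius) := differentiableOn_columnWave h1 h2
  have hc : ∀ m n, DifferentiableOn ℂ (fun t => (ofData x y z t).diag m n)
      (Metric.ball 0 dataRadius) := differentiableOn_diagWave h1 h2
  have hc' : ∀ m n, DifferentiableOn ℂ (fun t => (ofData x y z t).diagLeft m n)
      (Metric.ball 0 dataRadius) := differentiableOn_diagWaveLeft h1 h2
  obtain ⟨m, n, b⟩ := s
  cases b <;> simp only [tileDefect, shapeDefect, hexForm] <;> fun_prop

/-- If the leading coefficients of the defects are nonzero and distinct, then so are the defects
themselves, except for countably many values of the parameter. -/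
theorem countable_bad_parameter (hx : ∀ n, ‖x n‖ ≤ w n) (hy : ∀ n, ‖y n‖ ≤ w n)
    (hz : ∀ n, ‖z n‖ ≤ w n) (hx0 : ∀ s : TileIndex, (y s.1 + z (diagIndex s)) ^ 2
      + (x s.2.1 - z (diagIndex s)) ^ 2 + (x s.2.1 + y s.1) ^ 2 ≠ 0)
    (hinj : Function.Injective fun s : TileIndex => (y s.1 + z (diagIndex s)) ^ 2
      + (x s.2.1 - z (diagIndex s)) ^ 2 + (x s.2.1 + y s.1) ^ 2) :
    {t ∈ Metric.ball (0 : ℂ) dataRadius | ¬ (Function.Injective (tileDefect (ofData x y z t)) ∧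
      ∀ s, tileDefect (ofData x y z t) s ≠ 0)}.Countable := by
  have hD := differentiableOn_tileDefect hx hy hz
  have hT := tendsto_tileDefect_div hx hy hz
  have hball : ∀ᶠ t in 𝓝[≠] (0 : ℂ), t ∈ Metric.ball (0 : ℂ) dataRadius :=
    mem_nhdsWithin_of_mem_nhds (Metric.ball_mem_nhds 0 dataRadius_pos)
  have c1 : ∀ s, {t ∈ Metric.ball (0 : ℂ) dataRadius |
      tileDefect (ofData x y z t) s = 0}.Countable := fun s => by
    -- If the defect vanished on the whole ball, its quotient by `t ^ 2` would tend to `0` as well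
    -- as to the nonzero leading coefficient.
    refine countable_zeros_of_differentiableOn (hD s) fun h0 => hx0 s ?_
    refine tendsto_nhds_unique (hT s) ((tendsto_congr' ?_).mpr tendsto_const_nhds)
    filter_upwards [hball] with t ht
    simp [show tileDefect (ofData x y z t) s = 0 from h0 ht]
  have c2 : ∀ s s', s ≠ s' → {t ∈ Metric.ball (0 : ℂ) dataRadius |
      tileDefect (ofData x y z t) s - tileDefect (ofData x y z t) s' = 0}.Countable :=
    fun s s' hs => by
    refine countable_zeros_of_differentiableOn ((hD s).sub (hD s')) fun h0 => hs (hinj ?_)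
    refine tendsto_nhds_unique (hT s) ((tendsto_congr' ?_).mpr (hT s'))
    filter_upwards [hball] with t ht
    rw [sub_eq_zero.mp (show tileDefect (ofData x y z t) s - tileDefect (ofData x y z t) s' = 0
      from h0 ht)]
  refine ((Set.countable_iUnion c1).union (Set.countable_iUnion fun s => Set.countable_iUnion
    fun s' => Set.countable_iUnion fun hs => c2 s s' hs)).mono ?_
  rintro t ⟨ht, h⟩
  rw [not_and_or] at h
  simp only [Set.mem_union, Set.mem_iUnion, Set.mem_ofPred_eq]
  rcases h with h | h
  · right
    simp only [Function.Injective, not_forall] at h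
    obtain ⟨s, s', h1, h2⟩ := h
    exact ⟨s, s', h2, ht, sub_eq_zero.mpr h1⟩
  · left
    push Not at h
    obtain ⟨s, hs⟩ := h
    exact ⟨s, ht, hs⟩

end OfData

/-- The field of real parts. -/
noncomputable def re (F : WaveField ℂ) : WaveField ℝ where
  row m n := (F.row m n).re
  column m n := (F.column m n).re
  diag m n := (F.diag m n).re
  diagLeft m n := (F.diagLeft m n).re

/-- All waves are real. -/
structure IsReal (F : WaveField ℂ) : Prop where
  row : ∀ m n, (F.row m n).im = 0
  column : ∀ m n, (F.column m n).im = 0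
  diag : ∀ m n, (F.diag m n).im = 0
  diagLeft : ∀ m n, (F.diagLeft m n).im = 0

theorem IsReal.isSolution_re {F : WaveField ℂ} (hF : F.IsReal) (h : F.IsSolution) :
    F.re.IsSolution where
  up m n := by simpa [re, hF.row, hF.column, hF.diag] using congrArg Complex.re (h.up m n)
  down m n := by
    simpa [re, hF.row, hF.column, hF.diag] using congrArg Complex.re (h.down m n)
  closed_fst m n := by simpa [re] using congrArg Complex.re (h.closed_fst m n)
  closed_snd m n := by simpa [re] using congrArg Complex.re (h.closed_snd m n)

theorem ofReal_shapeDefect (a b c c' : ℝ) :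
    ((shapeDefect a b c c' : ℝ) : ℂ) = shapeDefect (a : ℂ) b c c' := by
  simp [shapeDefect, hexForm]

theorem IsReal.ofReal_tileDefect {F : WaveField ℂ} (hF : F.IsReal) (s : TileIndex) :
    ((tileDefect F.re s : ℝ) : ℂ) = tileDefect F s := by
  have h : ∀ v : ℂ, v.im = 0 → (v.re : ℂ) = v := fun v hv => Complex.ext rfl (by simp [hv])
  obtain ⟨m, n, b⟩ := s
  cases b <;> simp [tileDefect, ofReal_shapeDefect, re, h, hF.row, hF.column, hF.diag, hF.diagLeft]

/-- Data for which the leading coefficients of the defects are nonzero and distinct. -/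
theorem exists_generic_data : ∃ x y z : ℤ → ℝ, (∀ n, |x n| ≤ w n) ∧ (∀ n, |y n| ≤ w n) ∧
    (∀ n, |z n| ≤ w n) ∧
    (∀ s : TileIndex, (y s.1 + z (diagIndex s)) ^ 2 + (x s.2.1 - z (diagIndex s)) ^ 2
      + (x s.2.1 + y s.1) ^ 2 ≠ 0) ∧
    Function.Injective fun s : TileIndex => (y s.1 + z (diagIndex s)) ^ 2
      + (x s.2.1 - z (diagIndex s)) ^ 2 + (x s.2.1 + y s.1) ^ 2 := by
  obtain ⟨θ, ⟨h0, h1⟩, hθ⟩ := exists_transcendental_mem_Ioo (a := 0) (b := 1 / 2) (by norm_num)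
  have hb : ∀ (n : ℤ) (i : ℕ), |θ ^ 4 ^ (3 * intCode n + i)| ≤ w n := fun n i => by
    rw [abs_of_pos (by positivity)]
    exact pow_four_pow_le_quadWeight h0 h1 (by have := natAbs_le_intCode n; omega)
  -- The negative sign of `y` turns the leading coefficient into the sum of the squared differences
  -- of three powers of `θ`, which is symmetric in them.
  have hval : ∀ a b c : ℕ, (-θ ^ 4 ^ b + θ ^ 4 ^ c) ^ 2 + (θ ^ 4 ^ a - θ ^ 4 ^ c) ^ 2
      + (θ ^ 4 ^ a + -θ ^ 4 ^ b) ^ 2 = 2 * Polynomial.aeval θ (triplePoly a b c) := fun a b c => by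
    simp only [triplePoly, map_sub, map_add, map_mul, map_pow, Polynomial.aeval_X, pow_add,
      pow_mul']
    ring
  have hinj := transcendental_iff_injective.mp hθ
  -- The residue mod `3` records the family of the wave and the quotient records the strip, so the
  -- unordered triple of exponents recovered from the polynomial determines the triangle.
  refine ⟨fun n => θ ^ 4 ^ (3 * intCode n + 0), fun n => -θ ^ 4 ^ (3 * intCode n + 1),
    fun n => θ ^ 4 ^ (3 * intCode n + 2), fun n => hb n 0, fun n => ?_, fun n => hb n 2,
    fun s => ?_, fun s s' h => ?_⟩
  · rw [abs_neg]; exact hb n 1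
  · rw [hval]
    have h2 := triplePoly_ne_zero (a := 3 * intCode s.2.1 + 0) (b := 3 * intCode s.1 + 1)
      (c := 3 * intCode (diagIndex s) + 2) (by omega) (by omega) (by omega)
    refine mul_ne_zero two_ne_zero fun h => h2 (hinj ?_)
    rw [h, map_zero]
  · simp only [hval] at h
    have h2 := triplePoly_inj (by omega) (by omega) (by omega) (by omega) (by omega) (by omega)
      (hinj (mul_left_cancel₀ two_ne_zero h))
    have e1 := (h2 (3 * intCode s.2.1 + 0)).mp (by simp)
    have e2 := (h2 (3 * intCode s.1 + 1)).mp (by simp)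
    have e3 := (h2 (3 * intCode (diagIndex s) + 2)).mp (by simp)
    exact tileIndex_ext (intCode_injective (by omega)) (intCode_injective (by omega))
      (intCode_injective (by omega))

/-- There are arbitrarily small solutions in which the triangles have distinct nonzero defects. -/
theorem exists_solution {κ : ℝ} (hκ : 0 < κ) : ∃ F : WaveField ℝ, F.IsSolution ∧
    (∀ m n, |F.row m n| ≤ κ * w n ∧ |F.column m n| ≤ κ * w m ∧ |F.diag m n| ≤ κ * w (m + n) ∧
      |F.diagLeft m n| ≤ κ * w (m + n)) ∧
    Function.Injective F.tileDefect ∧ ∀ s, F.tileDefect s ≠ 0 := by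
  obtain ⟨x, y, z, hx, hy, hz, h0, hinj⟩ := exists_generic_data
  have hn : ∀ {v : ℤ → ℝ}, (∀ n, |v n| ≤ w n) → ∀ n, ‖(v n : ℂ)‖ ≤ w n := fun hv n => by
    rw [Complex.norm_real]; exact hv n
  have hbad := countable_bad_parameter (hn hx) (hn hy) (hn hz)
    (fun s => by exact_mod_cast h0 s)
    (fun s s' h => hinj (by
      beta_reduce at h ⊢
      exact_mod_cast h))
  -- Half of `κ` because the waves can reach size `2 * ‖t‖` times the weight.
  have hpos : 0 < min (κ / 2) Interaction.dataRadius :=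
    lt_min (by positivity) Interaction.dataRadius_pos
  obtain ⟨t, ⟨ht0, ht1⟩, hgood⟩ := exists_mem_Ioo_notMem_of_countable
    (hbad.preimage Complex.ofReal_injective) hpos
  have hnt : ‖(t : ℂ)‖ = t := by rw [Complex.norm_real, Real.norm_of_nonneg ht0.le]
  have htr : ‖(t : ℂ)‖ < Interaction.dataRadius := by
    rw [hnt]; exact ht1.trans_le (min_le_right _ _)
  have htκ : 2 * ‖(t : ℂ)‖ ≤ κ := by
    rw [hnt]; linarith [ht1.trans_le (min_le_left _ _)]
  set F := ofData (fun n => (x n : ℂ)) (fun n => (y n : ℂ)) (fun n => (z n : ℂ)) t with hF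
  have hgood : Function.Injective F.tileDefect ∧ ∀ s, F.tileDefect s ≠ 0 := by
    by_contra h
    exact hgood ⟨mem_ball_zero_iff.mpr htr, h⟩
  have hQ := Interaction.isReal_limit (fun n => Complex.ofReal_im (x n))
    (fun n => Complex.ofReal_im (y n)) (fun n => Complex.ofReal_im (z n)) (hn hx) (hn hy) (hn hz)
    (Complex.ofReal_im t) htr.le
  have hs : ∀ (v : ℤ → ℝ) (n : ℤ), (((t : ℂ) • fun n => (v n : ℂ)) n).im = 0 := fun v n => by
    simp
  have hre : F.IsReal := ⟨Interaction.im_rowWave (hs x) hQ, Interaction.im_columnWave (hs y) hQ,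
    Interaction.im_diagWave (hs z) hQ, Interaction.im_diagWaveLeft (hs z) hQ⟩
  refine ⟨F.re, hre.isSolution_re (isSolution_ofData (hn hx) (hn hy) (hn hz) htr.le),
    fun m n => ?_, fun s s' h => ?_, fun s h => ?_⟩
  · obtain ⟨h1, h2, h3, h4⟩ := norm_ofData_le (hn hx) (hn hy) (hn hz) htr.le m n
    have hk := fun k => mul_le_mul_of_nonneg_right htκ (quadWeight_pos k).le
    exact ⟨((Complex.abs_re_le_norm _).trans h1).trans (hk _),
      ((Complex.abs_re_le_norm _).trans h2).trans (hk _),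
      ((Complex.abs_re_le_norm _).trans h3).trans (hk _),
      ((Complex.abs_re_le_norm _).trans h4).trans (hk _)⟩
  · refine hgood.1 ?_
    rw [← hre.ofReal_tileDefect, ← hre.ofReal_tileDefect, h]
  · refine hgood.2 s ?_
    rw [← hre.ofReal_tileDefect, h, Complex.ofReal_zero]

end WaveField

end

/-! ### Piecewise linear maps on the standard triangulation -/

section PiecewiseLinear

variable {E : Type*} [NormedAddCommGroup E] [NormedSpace ℝ E]

/-- The vertices of a triangle of the triangular lattice, in lattice coordinates. -/
def tileVertex : TileIndex → Fin 3 → ℤ × ℤ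
  | (m, n, true) => ![(m, n), (m + 1, n), (m, n + 1)]
  | (m, n, false) => ![(m + 1, n + 1), (m, n + 1), (m + 1, n)]

/-- The barycentric coordinates with respect to a triangle of the triangular lattice. -/
def bary : TileIndex → ℝ × ℝ → Fin 3 → ℝ
  | (m, n, true), p => ![m + n + 1 - p.1 - p.2, p.1 - m, p.2 - n]
  | (m, n, false), p => ![p.1 + p.2 - m - n - 1, m + 1 - p.1, n + 1 - p.2]

/-- A triangle of the triangular lattice, in lattice coordinates. -/
def stdTile (s : TileIndex) : Set (ℝ × ℝ) := {p | ∀ i, 0 ≤ bary s p i}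

theorem sum_bary (s : TileIndex) (p : ℝ × ℝ) : ∑ i, bary s p i = 1 := by
  obtain ⟨m, n, b⟩ := s
  cases b <;> simp [bary, Fin.sum_univ_three] <;> ring

/-- A lattice point as a point of the coordinate plane. -/
def coordPoint (v : ℤ × ℤ) : ℝ × ℝ := (v.1, v.2)

theorem sum_bary_smul (s : TileIndex) (p : ℝ × ℝ) :
    ∑ i, bary s p i • coordPoint (tileVertex s i) = p := by
  obtain ⟨m, n, b⟩ := s
  obtain ⟨x, y⟩ := p
  cases b <;> simp [bary, Fin.sum_univ_three, tileVertex, coordPoint] <;> constructor <;> ring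

theorem bary_sum_smul (s : TileIndex) {l : Fin 3 → ℝ} (hl : ∑ i, l i = 1) :
    bary s (∑ i, l i • coordPoint (tileVertex s i)) = l := by
  obtain ⟨m, n, b⟩ := s
  rw [Fin.sum_univ_three] at hl
  funext i
  cases b <;> fin_cases i <;>
    simp [bary, Fin.sum_univ_three, tileVertex, coordPoint] <;> grind

/-- Piecewise linear interpolation of a function on the triangular lattice. -/
noncomputable def plInterp (u : ℤ → ℤ → E) (p : ℝ × ℝ) : E :=
  if Int.fract p.1 + Int.fract p.2 ≤ 1 then
    ∑ i, bary (⌊p.1⌋, ⌊p.2⌋, true) p i •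
      u (tileVertex (⌊p.1⌋, ⌊p.2⌋, true) i).1 (tileVertex (⌊p.1⌋, ⌊p.2⌋, true) i).2
  else
    ∑ i, bary (⌊p.1⌋, ⌊p.2⌋, false) p i •
      u (tileVertex (⌊p.1⌋, ⌊p.2⌋, false) i).1 (tileVertex (⌊p.1⌋, ⌊p.2⌋, false) i).2

/-- The triangles cover the plane. -/
theorem exists_mem_stdTile (p : ℝ × ℝ) : ∃ s, p ∈ stdTile s := by
  have h1 := Int.floor_le p.1
  have h2 := Int.floor_le p.2
  have h3 := (Int.lt_floor_add_one p.1).le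
  have h4 := (Int.lt_floor_add_one p.2).le
  rcases le_total (Int.fract p.1 + Int.fract p.2) 1 with h | h
  · refine ⟨(⌊p.1⌋, ⌊p.2⌋, true), fun i => ?_⟩
    unfold Int.fract at h
    fin_cases i <;> simp [bary] <;> linarith
  · refine ⟨(⌊p.1⌋, ⌊p.2⌋, false), fun i => ?_⟩
    unfold Int.fract at h
    fin_cases i <;> simp [bary] <;> linarith

/-- The definition selects one triangle by integer parts; on common edges and vertices the affine
formulas of the neighbours agree. The cases are the boundary positions in which `p` is assigned to a
triangle other than `s`. -/
theorem plInterp_eq (u : ℤ → ℤ → E) {s : TileIndex} {p : ℝ × ℝ} (hp : p ∈ stdTile s) :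
    plInterp u p = ∑ i, bary s p i • u (tileVertex s i).1 (tileVertex s i).2 := by
  obtain ⟨m, n, b⟩ := s
  obtain ⟨x, y⟩ := p
  have h0 := hp 0
  have h1 := hp 1
  have h2 := hp 2
  unfold plInterp Int.fract
  cases b
  · simp only [bary, Matrix.cons_val] at h0 h1 h2
    rcases (show x ≤ m + 1 by linarith).eq_or_lt with hx | hx
    · have fx : ⌊x⌋ = m + 1 := by rw [Int.floor_eq_iff]; push_cast; constructor <;> linarith
      rcases (show y ≤ n + 1 by linarith).eq_or_lt with hy | hy
      · have fy : ⌊y⌋ = n + 1 := by rw [Int.floor_eq_iff]; push_cast; constructor <;> linarith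
        subst hx hy
        rw [if_pos (by simp only [fx, fy]; push_cast; linarith)]
        simp only [fx, fy, bary, tileVertex, Fin.sum_univ_three, Matrix.cons_val]
        push_cast
        module
      · have fy : ⌊y⌋ = n := by rw [Int.floor_eq_iff]; constructor <;> linarith
        subst hx
        rw [if_pos (by simp only [fx, fy]; push_cast; linarith)]
        simp only [fx, fy, bary, tileVertex, Fin.sum_univ_three, Matrix.cons_val]
        push_cast
        module
    · have fx : ⌊x⌋ = m := by rw [Int.floor_eq_iff]; constructor <;> linarith
      rcases (show y ≤ n + 1 by linarith).eq_or_lt with hy | hy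
      · have fy : ⌊y⌋ = n + 1 := by rw [Int.floor_eq_iff]; push_cast; constructor <;> linarith
        subst hy
        rw [if_pos (by simp only [fx, fy]; push_cast; linarith)]
        simp only [fx, fy, bary, tileVertex, Fin.sum_univ_three, Matrix.cons_val]
        push_cast
        module
      · have fy : ⌊y⌋ = n := by rw [Int.floor_eq_iff]; constructor <;> linarith
        simp only [fx, fy]
        split_ifs with h
        · obtain rfl : y = m + n + 1 - x := by linarith
          simp only [bary, tileVertex, Fin.sum_univ_three, Matrix.cons_val]
          module
        · rfl
  · simp only [bary, Matrix.cons_val] at h0 h1 h2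
    rcases (show x ≤ m + 1 by linarith).eq_or_lt with hx | hx
    · have fx : ⌊x⌋ = m + 1 := by rw [Int.floor_eq_iff]; push_cast; constructor <;> linarith
      have hy : y = n := by linarith
      have fy : ⌊y⌋ = n := by rw [hy, Int.floor_intCast]
      subst hx hy
      rw [if_pos (by simp only [fx, fy]; push_cast; linarith)]
      simp only [fx, fy, bary, tileVertex, Fin.sum_univ_three, Matrix.cons_val]
      push_cast
      module
    · have fx : ⌊x⌋ = m := by rw [Int.floor_eq_iff]; constructor <;> linarith
      rcases (show y ≤ n + 1 by linarith).eq_or_lt with hy | hy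
      · have fy : ⌊y⌋ = n + 1 := by rw [Int.floor_eq_iff]; push_cast; constructor <;> linarith
        have hx : x = m := by linarith
        subst hx hy
        rw [if_pos (by simp only [fx, fy]; push_cast; linarith)]
        simp only [fx, fy, bary, tileVertex, Fin.sum_univ_three, Matrix.cons_val]
        push_cast
        module
      · have fy : ⌊y⌋ = n := by rw [Int.floor_eq_iff]; constructor <;> linarith
        simp only [fx, fy]
        rw [if_pos (by linarith)]

/-- Reflection in the main diagonal preserves the triangulation. This reduces vertical Lipschitz
bounds to horizontal ones. -/
theorem plInterp_swap (u : ℤ → ℤ → E) (x y : ℝ) :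
    plInterp u (x, y) = plInterp (fun n m => u m n) (y, x) := by
  simp only [plInterp, bary, tileVertex, Fin.sum_univ_three, Matrix.cons_val,
    add_comm (Int.fract x)]
  split_ifs <;> module

/-- A function that is Lipschitz on all unit intervals with integer endpoints is Lipschitz. -/
theorem norm_sub_le_of_unit_intervals {E : Type*} [NormedAddCommGroup E] {g : ℝ → E} {K : ℝ}
    (h : ∀ (m : ℤ) (a b : ℝ), (m : ℝ) ≤ a → a ≤ b → b ≤ m + 1 → ‖g b - g a‖ ≤ K * (b - a))
    {a b : ℝ} (hab : a ≤ b) : ‖g b - g a‖ ≤ K * (b - a) := by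
  have hint : ∀ (m : ℤ) (k : ℕ), ‖g ((m + k : ℤ) : ℝ) - g m‖ ≤ K * k := fun m k => by
    induction k with
    | zero => simp
    | succ k ih =>
      have h1 := h (m + k) ((m + k : ℤ) : ℝ) ((m + (k + 1 : ℕ) : ℤ) : ℝ) le_rfl
        (by push_cast; linarith) (by push_cast; linarith)
      have h2 := norm_sub_le_norm_sub_add_norm_sub (g ((m + (k + 1 : ℕ) : ℤ) : ℝ))
        (g ((m + k : ℤ) : ℝ)) (g m)
      push_cast at h1 h2 ih ⊢
      linarith
  have ha := Int.floor_le a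
  have ha' := Int.lt_floor_add_one a
  have hb := Int.floor_le b
  have hb' := Int.lt_floor_add_one b
  have hle := Int.floor_le_floor hab
  rcases hle.eq_or_lt with he | hlt
  · exact h ⌊a⌋ a b ha hab (by rw [he]; exact hb'.le)
  · obtain ⟨k, hk⟩ := Int.le.dest (show ⌊a⌋ + 1 ≤ ⌊b⌋ by omega)
    have hkr : (⌊b⌋ : ℝ) = ⌊a⌋ + 1 + k := by rw [← hk]; push_cast; ring
    have h1 := h ⌊a⌋ a (⌊a⌋ + 1) ha ha'.le le_rfl
    have h2 := hint (⌊a⌋ + 1) k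
    rw [hk] at h2
    push_cast at h2
    have h3 := h ⌊b⌋ ⌊b⌋ b le_rfl hb hb'.le
    have e : g b - g a = (g b - g ⌊b⌋) + ((g ⌊b⌋ - g (⌊a⌋ + 1)) + (g (⌊a⌋ + 1) - g a)) := by abel
    rw [e]
    refine (norm_add_le_of_le h3 (norm_add_le_of_le h2 h1)).trans (le_of_eq ?_)
    rw [hkr]; ring

theorem norm_plInterp_sub_le_fst {u : ℤ → ℤ → E} {K : ℝ}
    (h : ∀ m n, ‖u (m + 1) n - u m n‖ ≤ K) {a b : ℝ} (y : ℝ) (hab : a ≤ b) :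
    ‖plInterp u (b, y) - plInterp u (a, y)‖ ≤ K * (b - a) := by
  refine norm_sub_le_of_unit_intervals (g := fun x => plInterp u (x, y)) (fun m a b ha hab hb => ?_)
    hab
  have hy := Int.floor_le y
  have hy' := Int.lt_floor_add_one y
  set n := ⌊y⌋
  have hup : ∀ x : ℝ, (m : ℝ) ≤ x → x + y ≤ m + n + 1 →
      plInterp u (x, y) = ∑ i, bary (m, n, true) (x, y) i •
        u (tileVertex (m, n, true) i).1 (tileVertex (m, n, true) i).2 := fun x h1 h2 =>
    plInterp_eq u fun i => by fin_cases i <;> simp [bary] <;> linarith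
  have hdown : ∀ x : ℝ, x ≤ m + 1 → m + n + 1 ≤ x + y →
      plInterp u (x, y) = ∑ i, bary (m, n, false) (x, y) i •
        u (tileVertex (m, n, false) i).1 (tileVertex (m, n, false) i).2 := fun x h1 h2 =>
    plInterp_eq u fun i => by fin_cases i <;> simp [bary] <;> linarith
  have key : ∀ {v : E} {r : ℝ}, ‖v‖ ≤ K → 0 ≤ r → ‖r • v‖ ≤ K * r := fun hv hr => by
    rw [norm_smul, Real.norm_of_nonneg hr, mul_comm]
    exact mul_le_mul_of_nonneg_right hv hr
  have l1 : ∀ a b : ℝ, (m : ℝ) ≤ a → a ≤ b → b + y ≤ m + n + 1 →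
      ‖plInterp u (b, y) - plInterp u (a, y)‖ ≤ K * (b - a) := fun a b h1 h2 h3 => by
    rw [hup a h1 (by linarith), hup b (by linarith) h3]
    convert key (h m n) (sub_nonneg.mpr h2) using 2
    simp only [bary, tileVertex, Fin.sum_univ_three, Matrix.cons_val]
    module
  have l2 : ∀ a b : ℝ, m + n + 1 ≤ a + y → a ≤ b → b ≤ m + 1 →
      ‖plInterp u (b, y) - plInterp u (a, y)‖ ≤ K * (b - a) := fun a b h1 h2 h3 => by
    rw [hdown a (by linarith) h1, hdown b h3 (by linarith)]
    convert key (h m (n + 1)) (sub_nonneg.mpr h2) using 2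
    simp only [bary, tileVertex, Fin.sum_univ_three, Matrix.cons_val]
    module
  -- On a horizontal unit interval the interpolation has one possible break, at the hypotenuse; on
  -- either side its slope is the difference of `u` along a horizontal edge.
  set c : ℝ := m + n + 1 - y with hc
  rcases le_total b c with hbc | hbc
  · exact l1 a b ha hab (by linarith)
  rcases le_total a c with hac | hac
  · have e := norm_sub_le_norm_sub_add_norm_sub (plInterp u (b, y)) (plInterp u (c, y))
      (plInterp u (a, y))
    have e1 := l1 a c ha hac (by linarith)
    have e2 := l2 c b (by linarith) hbc hb
    linarith
  · exact l2 a b (by linarith) hab hb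

theorem norm_plInterp_sub_le {u : ℤ → ℤ → E} {K : ℝ}
    (h1 : ∀ m n, ‖u (m + 1) n - u m n‖ ≤ K) (h2 : ∀ m n, ‖u m (n + 1) - u m n‖ ≤ K)
    (p q : ℝ × ℝ) : ‖plInterp u p - plInterp u q‖ ≤ K * (|p.1 - q.1| + |p.2 - q.2|) := by
  have key : ∀ {v : ℤ → ℤ → E}, (∀ m n, ‖v (m + 1) n - v m n‖ ≤ K) → ∀ a b y : ℝ,
      ‖plInterp v (a, y) - plInterp v (b, y)‖ ≤ K * |a - b| := fun hv a b y => by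
    rcases le_total a b with hab | hab
    · rw [norm_sub_rev, abs_sub_comm, abs_of_nonneg (sub_nonneg.mpr hab)]
      exact norm_plInterp_sub_le_fst hv y hab
    · rw [abs_of_nonneg (sub_nonneg.mpr hab)]
      exact norm_plInterp_sub_le_fst hv y hab
  obtain ⟨a, b⟩ := p
  obtain ⟨c, d⟩ := q
  have e1 := key h1 a c b
  have e2 := key (v := fun n m => u m n) (fun n m => h2 m n) b d c
  rw [← plInterp_swap u c b, ← plInterp_swap u c d] at e2
  have e3 := norm_sub_le_norm_sub_add_norm_sub (plInterp u (a, b)) (plInterp u (c, b))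
    (plInterp u (c, d))
  rw [mul_add]
  exact e3.trans (add_le_add e1 e2)

/-- The piecewise linear map that displaces the lattice points by `u`. -/
noncomputable def plMap (u : ℤ → ℤ → ℝ × ℝ) (p : ℝ × ℝ) : ℝ × ℝ := p + plInterp u p

theorem plMap_eq (u : ℤ → ℤ → ℝ × ℝ) {s : TileIndex} {p : ℝ × ℝ} (hp : p ∈ stdTile s) :
    plMap u p = ∑ i, bary s p i •
      (coordPoint (tileVertex s i) + u (tileVertex s i).1 (tileVertex s i).2) := by
  simp only [plMap, plInterp_eq u hp, smul_add, Finset.sum_add_distrib, sum_bary_smul]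

/-- The interpolated displacement is `1 / 2`-Lipschitz in the maximum norm, as `|p.1 - q.1| + |p.2 -
q.2|` is at most twice that norm. Surjectivity is then the Banach fixed point theorem. -/
theorem plMap_bijective {u : ℤ → ℤ → ℝ × ℝ} (h1 : ∀ m n, ‖u (m + 1) n - u m n‖ ≤ 1 / 4)
    (h2 : ∀ m n, ‖u m (n + 1) - u m n‖ ≤ 1 / 4) : Function.Bijective (plMap u) := by
  have hlip : ∀ p q, ‖plInterp u p - plInterp u q‖ ≤ 1 / 2 * ‖p - q‖ := fun p q => by
    have h := norm_plInterp_sub_le h1 h2 p q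
    have e1 := norm_fst_le (p - q)
    have e2 := norm_snd_le (p - q)
    rw [Real.norm_eq_abs] at e1 e2
    simp only [Prod.fst_sub, Prod.snd_sub] at e1 e2
    linarith
  constructor
  · intro p q hpq
    have h := hlip p q
    have e : plInterp u p - plInterp u q = -(p - q) := by
      unfold plMap at hpq
      linear_combination (exp := 1) hpq
    rw [e, norm_neg] at h
    exact sub_eq_zero.mp (norm_eq_zero.mp (le_antisymm (by linarith) (norm_nonneg _)))
  · intro y
    have hc : ContractingWith (1 / 2) fun p => y - plInterp u p := by
      refine ⟨by norm_num, LipschitzWith.of_dist_le_mul fun p q => ?_⟩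
      rw [dist_eq_norm, dist_eq_norm, sub_sub_sub_cancel_left, norm_sub_rev]
      simpa using hlip p q
    refine ⟨ContractingWith.fixedPoint _ hc, ?_⟩
    have h := hc.fixedPoint_isFixedPt
    unfold plMap
    nth_rewrite 1 [← h.eq]
    abel

/-- The common vertices of two triangles determine their intersection. -/
theorem exists_tileVertex_eq {s s' : TileIndex} {p : ℝ × ℝ} (hp : p ∈ stdTile s)
    (hp' : p ∈ stdTile s') {i : Fin 3} (hi : 0 < bary s p i) :
    ∃ j, tileVertex s' j = tileVertex s i := by
  obtain ⟨x, y⟩ := p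
  -- A positive barycentric coordinate places the point in the open hexagonal star of that vertex. A
  -- closed triangle meeting this star has the vertex among its own, which by integrality is a
  -- finite check.
  have hstar : |x - (tileVertex s i).1| < 1 ∧ |y - (tileVertex s i).2| < 1 ∧
      |x + y - ((tileVertex s i).1 + (tileVertex s i).2)| < 1 := by
    obtain ⟨m, n, b⟩ := s
    have h0 := hp 0
    have h1 := hp 1
    have h2 := hp 2
    simp only [abs_lt]
    cases b <;> fin_cases i <;> simp [bary, tileVertex] at h0 h1 h2 hi ⊢ <;>
      refine ⟨⟨?_, ?_⟩, ⟨?_, ?_⟩, ⟨?_, ?_⟩⟩ <;> linarith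
  generalize tileVertex s i = v at hstar ⊢
  obtain ⟨v, v'⟩ := v
  simp only [abs_lt] at hstar
  obtain ⟨⟨a1, a2⟩, ⟨a3, a4⟩, a5, a6⟩ := hstar
  obtain ⟨m, n, b⟩ := s'
  have h0 := hp' 0
  have h1 := hp' 1
  have h2 := hp' 2
  cases b
  · simp [bary] at h0 h1 h2
    have k1 : v < m + 2 := by exact_mod_cast (show (v : ℝ) < m + 2 by linarith)
    have k2 : v' < n + 2 := by exact_mod_cast (show (v' : ℝ) < n + 2 by linarith)
    have k3 : m < v + 1 := by exact_mod_cast (show (m : ℝ) < v + 1 by linarith)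
    have k4 : n < v' + 1 := by exact_mod_cast (show (n : ℝ) < v' + 1 by linarith)
    have k5 : m + n < v + v' := by exact_mod_cast (show (m : ℝ) + n < v + v' by linarith)
    have : (v = m + 1 ∧ v' = n + 1) ∨ (v = m ∧ v' = n + 1) ∨ (v = m + 1 ∧ v' = n) := by omega
    rcases this with ⟨rfl, rfl⟩ | ⟨rfl, rfl⟩ | ⟨rfl, rfl⟩
    · exact ⟨0, rfl⟩
    · exact ⟨1, rfl⟩
    · exact ⟨2, rfl⟩
  · simp [bary] at h0 h1 h2
    have k1 : v < m + 2 := by exact_mod_cast (show (v : ℝ) < m + 2 by linarith)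
    have k2 : v' < n + 2 := by exact_mod_cast (show (v' : ℝ) < n + 2 by linarith)
    have k3 : m < v + 1 := by exact_mod_cast (show (m : ℝ) < v + 1 by linarith)
    have k4 : n < v' + 1 := by exact_mod_cast (show (n : ℝ) < v' + 1 by linarith)
    have k5 : v + v' < m + n + 2 := by
      exact_mod_cast (show (v : ℝ) + v' < m + n + 2 by linarith)
    have : (v = m ∧ v' = n) ∨ (v = m + 1 ∧ v' = n) ∨ (v = m ∧ v' = n + 1) := by omega
    rcases this with ⟨rfl, rfl⟩ | ⟨rfl, rfl⟩ | ⟨rfl, rfl⟩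
    · exact ⟨0, rfl⟩
    · exact ⟨1, rfl⟩
    · exact ⟨2, rfl⟩

/-- A triangle is determined by its vertices. -/
theorem tileIndex_eq_of_vertices {s s' : TileIndex}
    (h : ∀ i, ∃ j, tileVertex s' j = tileVertex s i) : s = s' := by
  obtain ⟨m, n, b⟩ := s
  obtain ⟨m', n', b'⟩ := s'
  have h0 := h 0
  have h1 := h 1
  have h2 := h 2
  cases b <;> cases b' <;>
    simp [tileVertex, Fin.exists_fin_succ] at h0 h1 h2 ⊢ <;> omega

end PiecewiseLinear

/-! ### Triangles in the plane: vertices, congruence, area -/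

section

open MeasureTheory

section ConvexHull

variable {E : Type*} [AddCommGroup E] [Module ℝ E]

theorem mem_convexHull_range_iff {ι : Type*} [Fintype ι] {p : ι → E} {x : E} :
    x ∈ convexHull ℝ (Set.range p) ↔
      ∃ l : ι → ℝ, (∀ i, 0 ≤ l i) ∧ ∑ i, l i = 1 ∧ ∑ i, l i • p i = x := by
  classical
  have h : convexHull ℝ (Set.range p) =
      (Fintype.linearCombination ℝ p) '' stdSimplex ℝ ι := by
    rw [← convexHull_basis_eq_stdSimplex, LinearMap.image_convexHull, ← Set.range_comp]
    congr 2
    funext i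
    simp [Fintype.linearCombination_apply]
  rw [h]
  constructor
  · rintro ⟨l, ⟨h1, h2⟩, rfl⟩
    exact ⟨l, h1, h2, rfl⟩
  · rintro ⟨l, h1, h2, rfl⟩
    exact ⟨l, ⟨h1, h2⟩, rfl⟩

theorem AffineIndependent.mem_extremePoints_convexHull {ι : Type*} [Fintype ι] {p : ι → E}
    (hp : AffineIndependent ℝ p) (j : ι) : p j ∈ (convexHull ℝ (Set.range p)).extremePoints ℝ := by
  classical
  rw [mem_extremePoints_iff_left]
  refine ⟨subset_convexHull ℝ _ ⟨j, rfl⟩, fun x hx y hy hj => ?_⟩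
  obtain ⟨a, ha0, ha1, rfl⟩ := mem_convexHull_range_iff.mp hx
  obtain ⟨b, hb0, hb1, rfl⟩ := mem_convexHull_range_iff.mp hy
  obtain ⟨c, d, hc, hd, hcd, hj⟩ := hj
  have key := affineIndependent_iff.mp hp Finset.univ
    (fun i => c * a i + d * b i - if i = j then 1 else 0)
    (by simp [Finset.sum_sub_distrib, Finset.sum_add_distrib, ← Finset.mul_sum, ha1, hb1, hcd])
    (by
      simp only [sub_smul, add_smul, mul_smul, Finset.sum_sub_distrib, Finset.sum_add_distrib,
        ← Finset.smul_sum, hj, ite_smul, one_smul, zero_smul]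
      simp)
  have hz : ∀ i, i ≠ j → a i = 0 := fun i hi => by
    have h := key i (Finset.mem_univ i)
    rw [if_neg hi, sub_zero] at h
    have h1 := mul_nonneg hc.le (ha0 i)
    have h2 := mul_nonneg hd.le (hb0 i)
    have h3 : c * a i = 0 := by linarith
    exact (mul_eq_zero.mp h3).resolve_left hc.ne'
  rw [Finset.sum_eq_single j (fun i _ hi => by rw [hz i hi, zero_smul]) (by simp)]
  rw [Finset.sum_eq_single j (fun i _ hi => hz i hi) (by simp)] at ha1
  rw [ha1, one_smul]

end ConvexHull

namespace PlaneTriangle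

theorem mem_tile_iff {t : PlaneTriangle} {x : Plane} :
    x ∈ t.tile ↔ ∃ l : Fin 3 → ℝ, (∀ i, 0 ≤ l i) ∧ ∑ i, l i = 1 ∧ ∑ i, l i • t.points i = x :=
  mem_convexHull_range_iff (ι := Fin 3)

theorem points_mem_tile (t : PlaneTriangle) (i : Fin 3) : t.points i ∈ t.tile :=
  subset_convexHull ℝ _ ⟨i, rfl⟩

theorem segment_subset_tile (t : PlaneTriangle) (i j : Fin 3) :
    segment ℝ (t.points i) (t.points j) ⊆ t.tile :=
  (convex_convexHull ℝ _).segment_subset (t.points_mem_tile i) (t.points_mem_tile j)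

/-- Congruent triangles have the same side lengths. -/
theorem IsCongruent.exists_perm {t t' : PlaneTriangle} (h : t.IsCongruent t') :
    ∃ σ : Equiv.Perm (Fin 3), ∀ i j,
      dist (t'.points i) (t'.points j) = dist (t.points (σ i)) (t.points (σ j)) := by
  obtain ⟨φ, hφ⟩ := h
  -- A surjective isometry is affine by Mazur–Ulam, so it commutes with convex hulls. The vertices
  -- of `t'` are then recovered as extreme points of the hull of the image vertices.
  have hhull : convexHull ℝ (Set.range t'.points) = convexHull ℝ (φ '' Set.range t.points) := by
    have h1 := AffineMap.image_convexHull
      (φ.toRealAffineIsometryEquiv.toAffineEquiv : Plane →ᵃ[ℝ] Plane) (Set.range t.points)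
    have h2 : ⇑(φ.toRealAffineIsometryEquiv.toAffineEquiv : Plane →ᵃ[ℝ] Plane) = φ := by
      ext1 x; simp
    rw [h2] at h1
    exact hφ.symm.trans h1
  have hmem : ∀ j, ∃ i, φ (t.points i) = t'.points j := fun j => by
    have h1 := t'.independent.mem_extremePoints_convexHull j
    rw [hhull] at h1
    obtain ⟨_, ⟨i, rfl⟩, hi⟩ := extremePoints_convexHull_subset h1
    exact ⟨i, hi⟩
  choose σ hσ using hmem
  have hinj : Function.Injective σ := fun i j hij =>
    t'.independent.injective (by rw [← hσ i, ← hσ j, hij])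
  refine ⟨Equiv.ofBijective σ (Finite.injective_iff_bijective.mp hinj), fun i j => ?_⟩
  rw [← hσ i, ← hσ j, φ.isometry.dist_eq]
  rfl

end PlaneTriangle

/-- Segments in the plane have no interior. -/
theorem interior_segment_eq_empty (a b : Plane) : interior (segment ℝ a b) = ∅ := by
  by_contra h
  rw [← ne_eq, ← Set.nonempty_iff_ne_empty, ← convexHull_pair,
    interior_convexHull_nonempty_iff_affineSpan_eq_top] at h
  have h1 := (collinear_iff_finrank_le_one (k := ℝ)).mp (collinear_pair ℝ a b)
  rw [← direction_affineSpan, h, AffineSubspace.direction_top, finrank_top,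
    finrank_euclideanSpace, Fintype.card_fin] at h1
  norm_num at h1

theorem volume_standard_triangle_prod :
    volume {p : ℝ × ℝ | 0 ≤ p.1 ∧ 0 ≤ p.2 ∧ p.1 + p.2 ≤ 1} = ENNReal.ofReal (1 / 2) := by
  have hm : MeasurableSet {p : ℝ × ℝ | 0 ≤ p.1 ∧ 0 ≤ p.2 ∧ p.1 + p.2 ≤ 1} := by
    apply IsClosed.measurableSet
    exact (isClosed_le continuous_const continuous_fst).inter
      ((isClosed_le continuous_const continuous_snd).inter
        (isClosed_le (continuous_fst.add continuous_snd) continuous_const))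
  rw [Measure.volume_eq_prod, Measure.prod_apply hm]
  have hs : ∀ x : ℝ, volume (Prod.mk x ⁻¹' {p : ℝ × ℝ | 0 ≤ p.1 ∧ 0 ≤ p.2 ∧ p.1 + p.2 ≤ 1})
      = (Set.Icc (0 : ℝ) 1).indicator (fun x => ENNReal.ofReal (1 - x)) x := fun x => by
    by_cases hx : x ∈ Set.Icc (0 : ℝ) 1
    · rw [Set.indicator_of_mem hx]
      have : Prod.mk x ⁻¹' {p : ℝ × ℝ | 0 ≤ p.1 ∧ 0 ≤ p.2 ∧ p.1 + p.2 ≤ 1}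
          = Set.Icc 0 (1 - x) := by
        ext y
        simp only [Set.mem_preimage, Set.mem_ofPred_eq, Set.mem_Icc]
        exact ⟨fun h => ⟨h.2.1, by linarith [h.2.2]⟩, fun h => ⟨hx.1, h.1, by linarith [h.2]⟩⟩
      rw [this, Real.volume_Icc, sub_zero]
    · rw [Set.indicator_of_notMem hx]
      have : Prod.mk x ⁻¹' {p : ℝ × ℝ | 0 ≤ p.1 ∧ 0 ≤ p.2 ∧ p.1 + p.2 ≤ 1} = ∅ := by
        ext y
        simp only [Set.mem_preimage, Set.mem_ofPred_eq, Set.mem_empty_iff_false, iff_false]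
        exact fun h => hx ⟨h.1, by linarith [h.2.1, h.2.2]⟩
      rw [this, measure_empty]
  simp_rw [hs]
  rw [lintegral_indicator measurableSet_Icc, ← ofReal_integral_eq_lintegral_ofReal]
  · rw [integral_Icc_eq_integral_Ioc, ← intervalIntegral.integral_of_le zero_le_one]
    congr 1
    rw [intervalIntegral.integral_sub (by simp) (by simp)]
    norm_num
  · exact (continuous_const.sub continuous_id).integrableOn_Icc
  · filter_upwards [ae_restrict_mem measurableSet_Icc] with x hx
    exact sub_nonneg.mpr hx.2

theorem volume_standard_triangle :
    volume {p : Plane | 0 ≤ p 0 ∧ 0 ≤ p 1 ∧ p 0 + p 1 ≤ 1} = ENNReal.ofReal (1 / 2) := by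
  rw [← volume_standard_triangle_prod]
  have h := (volume_preserving_finTwoArrow ℝ).comp (PiLp.volume_preserving_ofLp (Fin 2))
  have hm : MeasurableSet {p : ℝ × ℝ | 0 ≤ p.1 ∧ 0 ≤ p.2 ∧ p.1 + p.2 ≤ 1} := by
    apply IsClosed.measurableSet
    exact (isClosed_le continuous_const continuous_fst).inter
      ((isClosed_le continuous_const continuous_snd).inter
        (isClosed_le (continuous_fst.add continuous_snd) continuous_const))
  rw [← h.measure_preimage hm.nullMeasurableSet]
  rfl

/-- The area of a triangle by the determinant formula. -/
theorem PlaneTriangle.volume_tile (t : PlaneTriangle) :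
    volume t.tile = ENNReal.ofReal (|(t.points 1 0 - t.points 0 0) * (t.points 2 1 - t.points 0 1)
      - (t.points 2 0 - t.points 0 0) * (t.points 1 1 - t.points 0 1)| / 2) := by
  set M : Matrix (Fin 2) (Fin 2) ℝ :=
    !![t.points 1 0 - t.points 0 0, t.points 2 0 - t.points 0 0;
      t.points 1 1 - t.points 0 1, t.points 2 1 - t.points 0 1] with hM
  set f : Plane →ₗ[ℝ] Plane := Matrix.toLin (EuclideanSpace.basisFun (Fin 2) ℝ).toBasis
    (EuclideanSpace.basisFun (Fin 2) ℝ).toBasis M with hf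
  have hfx : ∀ x : Plane, f x = x 0 • (t.points 1 - t.points 0) + x 1 • (t.points 2 - t.points 0) :=
    fun x => by
      ext k
      rw [hf, Matrix.toLin_apply]
      fin_cases k <;>
        simp [Matrix.mulVec, hM, dotProduct, Fin.sum_univ_two] <;> ring
  have htile : t.tile = (fun x => t.points 0 + x) ''
      (f '' {p : Plane | 0 ≤ p 0 ∧ 0 ≤ p 1 ∧ p 0 + p 1 ≤ 1}) := by
    ext x
    rw [PlaneTriangle.mem_tile_iff]
    simp only [Fin.sum_univ_three, Set.mem_image]
    constructor
    · rintro ⟨l, h, hsum, rfl⟩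
      refine ⟨_, ⟨!₂[l 1, l 2], ⟨h 1, h 2, ?_⟩, rfl⟩, ?_⟩
      · have := h 0
        simp; linarith
      · rw [hfx, show l 0 = 1 - l 1 - l 2 by linarith]
        simp
        module
    · rintro ⟨_, ⟨p, ⟨h0, h1, h2⟩, rfl⟩, rfl⟩
      refine ⟨![1 - p 0 - p 1, p 0, p 1], fun i => ?_, ?_, ?_⟩
      · fin_cases i
        · simp; linarith
        · exact h0
        · exact h1
      · simp only [Matrix.cons_val]; ring
      · rw [hfx]
        simp
        module
  rw [htile, Set.image_add_left, measure_preimage_add, Measure.addHaar_image_linearMap,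
    volume_standard_triangle, hf, LinearMap.det_toLin, ← ENNReal.ofReal_mul (abs_nonneg _), hM,
    Matrix.det_fin_two_of]
  congr 1
  ring

end

/-! ### The tiling by displaced triangles -/

theorem unitSide_pos : 0 < unitSide := by
  unfold unitSide; positivity

/-- The left side is the determinant of `latticeMap`. Hence a triangle whose edge vectors have cross
product `1` in lattice coordinates has unit area in the plane. -/
theorem unitSide_sq_mul : unitSide ^ 2 * (√3 / 2) = 2 := by
  unfold unitSide
  rw [div_pow, Real.sq_sqrt (by positivity)]
  have : √3 ≠ 0 := by positivity
  field_simp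

/-- The linear map from lattice coordinates to the plane. -/
noncomputable def latticeMap : ℝ × ℝ →ₗ[ℝ] Plane where
  toFun p := !₂[unitSide * (p.1 + p.2 / 2), unitSide * (√3 / 2 * p.2)]
  map_add' p q := by ext k; fin_cases k <;> simp <;> ring
  map_smul' c p := by ext k; fin_cases k <;> simp <;> ring

theorem latticeMap_apply_zero (p : ℝ × ℝ) : latticeMap p 0 = unitSide * (p.1 + p.2 / 2) := rfl

theorem latticeMap_apply_one (p : ℝ × ℝ) : latticeMap p 1 = unitSide * (√3 / 2 * p.2) := rfl

theorem latticePoint_eq (v : ℤ × ℤ) : latticePoint v.1 v.2 = latticeMap (coordPoint v) := rfl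

theorem dist_latticeMap_sq (p q : ℝ × ℝ) :
    dist (latticeMap p) (latticeMap q) ^ 2 =
      unitSide ^ 2 * hexForm (p.1 - q.1) (p.2 - q.2) := by
  rw [EuclideanSpace.dist_eq, Real.sq_sqrt (by positivity), Fin.sum_univ_two, Real.dist_eq,
    Real.dist_eq, sq_abs, sq_abs]
  simp only [latticeMap_apply_zero, latticeMap_apply_one, hexForm]
  have h3 : √3 ^ 2 = 3 := Real.sq_sqrt (by norm_num)
  linear_combination unitSide ^ 2 * (p.2 - q.2) ^ 2 / 4 * h3

theorem latticeMap_injective : Function.Injective latticeMap := by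
  have h3 : (0 : ℝ) < √3 := by positivity
  have hs := unitSide_pos
  refine (injective_iff_map_eq_zero _).mpr fun p hp => ?_
  have h0 : unitSide * (p.1 + p.2 / 2) = 0 := by rw [← latticeMap_apply_zero, hp]; rfl
  have h1 : unitSide * (√3 / 2 * p.2) = 0 := by rw [← latticeMap_apply_one, hp]; rfl
  have h2 : p.2 = 0 := by
    rcases mul_eq_zero.mp h1 with h | h
    · exact absurd h hs.ne'
    · exact (mul_eq_zero.mp h).resolve_left (by positivity)
  have h4 : p.1 = 0 := by
    have := (mul_eq_zero.mp h0).resolve_left hs.ne'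
    rw [h2] at this
    linarith
  exact Prod.ext h4 h2

theorem latticeMap_surjective : Function.Surjective latticeMap := fun y => by
  have h3 : (0 : ℝ) < √3 := by positivity
  have hs := unitSide_pos
  refine ⟨(y 0 / unitSide - y 1 / (unitSide * √3), 2 * y 1 / (unitSide * √3)), ?_⟩
  ext k
  fin_cases k
  · change unitSide * _ = y 0
    field_simp
    ring
  · change unitSide * _ = y 1
    field_simp

/-- The cross product of two vectors of the coordinate plane. -/
def crossProd (p q : ℝ × ℝ) : ℝ := p.1 * q.2 - p.2 * q.1

/-- The displaced vertices of a triangle, in lattice coordinates. -/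
def displacedVertex (u : ℤ → ℤ → ℝ × ℝ) (s : TileIndex) (i : Fin 3) : ℝ × ℝ :=
  coordPoint (tileVertex s i) + u (tileVertex s i).1 (tileVertex s i).2

/-- The displacement makes all triangles have unit area. -/
def IsAreaPreserving (u : ℤ → ℤ → ℝ × ℝ) : Prop :=
  ∀ s, crossProd (displacedVertex u s 1 - displacedVertex u s 0)
    (displacedVertex u s 2 - displacedVertex u s 0) = 1

theorem affineIndependent_of_crossProd {p : Fin 3 → ℝ × ℝ}
    (h : crossProd (p 1 - p 0) (p 2 - p 0) ≠ 0) : AffineIndependent ℝ p := by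
  rw [affineIndependent_iff_eq_of_fintype_affineCombination_eq]
  intro a b ha hb hab
  rw [Finset.affineCombination_eq_linear_combination _ _ _ ha,
    Finset.affineCombination_eq_linear_combination _ _ _ hb] at hab
  simp only [Fin.sum_univ_three] at ha hb hab
  have h1 := congrArg Prod.fst hab
  have h2 := congrArg Prod.snd hab
  simp only [Prod.fst_add, Prod.snd_add, Prod.smul_fst, Prod.smul_snd, smul_eq_mul] at h1 h2
  simp only [crossProd, Prod.fst_sub, Prod.snd_sub] at h
  have e0 : a 0 - b 0 = -(a 1 - b 1) - (a 2 - b 2) := by linarith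
  have k1 : (a 1 - b 1) * ((p 1).1 - (p 0).1) + (a 2 - b 2) * ((p 2).1 - (p 0).1) = 0 := by
    linear_combination h1 - (p 0).1 * e0
  have k2 : (a 1 - b 1) * ((p 1).2 - (p 0).2) + (a 2 - b 2) * ((p 2).2 - (p 0).2) = 0 := by
    linear_combination h2 - (p 0).2 * e0
  have l1 : a 1 - b 1 = 0 := by
    refine (mul_eq_zero.mp ?_).resolve_right h
    linear_combination ((p 2).2 - (p 0).2) * k1 - ((p 2).1 - (p 0).1) * k2
  have l2 : a 2 - b 2 = 0 := by
    refine (mul_eq_zero.mp ?_).resolve_right h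
    linear_combination ((p 1).1 - (p 0).1) * k2 - ((p 1).2 - (p 0).2) * k1
  funext i
  fin_cases i
  · change a 0 = b 0; linarith
  · change a 1 = b 1; linarith
  · change a 2 = b 2; linarith

/-- The triangle of the plane with displaced vertices. -/
noncomputable def displacedTriangle {u : ℤ → ℤ → ℝ × ℝ} (hu : IsAreaPreserving u)
    (s : TileIndex) : PlaneTriangle where
  points i := latticeMap (displacedVertex u s i)
  independent := (affineIndependent_of_crossProd (by rw [hu s]; exact one_ne_zero)).map'
    latticeMap.toAffineMap latticeMap_injective

section Tiling

variable {u : ℤ → ℤ → ℝ × ℝ} (hu : IsAreaPreserving u)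

theorem displacedTriangle_points (s : TileIndex) (i : Fin 3) :
    (displacedTriangle hu s).points i = latticeMap (displacedVertex u s i) := rfl

theorem tile_displacedTriangle (s : TileIndex) :
    (displacedTriangle hu s).tile = (fun p => latticeMap (plMap u p)) '' stdTile s := by
  ext x
  rw [PlaneTriangle.mem_tile_iff]
  constructor
  · rintro ⟨l, h0, h1, rfl⟩
    have hb := bary_sum_smul s h1
    have hmem : ∑ i, l i • coordPoint (tileVertex s i) ∈ stdTile s := fun i => by
      rw [hb]; exact h0 i
    refine ⟨_, hmem, ?_⟩
    simp only [plMap_eq u hmem, hb, map_sum, map_smul]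
    rfl
  · rintro ⟨p, hp, rfl⟩
    refine ⟨bary s p, hp, sum_bary s p, ?_⟩
    simp only [plMap_eq u hp, map_sum, map_smul]
    rfl

theorem volume_displacedTriangle (s : TileIndex) :
    MeasureTheory.volume (displacedTriangle hu s).tile = 1 := by
  rw [PlaneTriangle.volume_tile]
  simp only [displacedTriangle_points, latticeMap_apply_zero, latticeMap_apply_one]
  have h := hu s
  simp only [crossProd, Prod.fst_sub, Prod.snd_sub] at h
  generalize displacedVertex u s 0 = a at h ⊢
  generalize displacedVertex u s 1 = b at h ⊢
  generalize displacedVertex u s 2 = c at h ⊢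
  have e : (unitSide * (b.1 + b.2 / 2) - unitSide * (a.1 + a.2 / 2)) *
      (unitSide * (√3 / 2 * c.2) - unitSide * (√3 / 2 * a.2)) -
      (unitSide * (c.1 + c.2 / 2) - unitSide * (a.1 + a.2 / 2)) *
      (unitSide * (√3 / 2 * b.2) - unitSide * (√3 / 2 * a.2)) = 2 := by
    linear_combination unitSide ^ 2 * (√3 / 2) * h + unitSide_sq_mul
  rw [e]
  norm_num

theorem hasUnitArea_displaced : HasUnitArea (Set.range (displacedTriangle hu)) := by
  rintro _ ⟨s, rfl⟩
  exact volume_displacedTriangle hu s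

theorem tile_inter_tile (h1 : ∀ m n, ‖u (m + 1) n - u m n‖ ≤ 1 / 4)
    (h2 : ∀ m n, ‖u m (n + 1) - u m n‖ ≤ 1 / 4) (s s' : TileIndex) :
    (displacedTriangle hu s).tile ∩ (displacedTriangle hu s').tile =
      (fun p => latticeMap (plMap u p)) '' (stdTile s ∩ stdTile s') := by
  rw [tile_displacedTriangle, tile_displacedTriangle]
  exact (Set.image_inter (latticeMap_injective.comp (plMap_bijective h1 h2).injective)).symm

/-- Two distinct triangles meet in a common edge, in a common vertex, or not at all. -/
theorem meet_displacedTriangle (h1 : ∀ m n, ‖u (m + 1) n - u m n‖ ≤ 1 / 4)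
    (h2 : ∀ m n, ‖u m (n + 1) - u m n‖ ≤ 1 / 4) {s s' : TileIndex} (hs : s ≠ s') :
    (displacedTriangle hu s).MeetInEdge (displacedTriangle hu s') ∨
      (displacedTriangle hu s).MeetInVertex (displacedTriangle hu s') ∨
      (displacedTriangle hu s).tile ∩ (displacedTriangle hu s').tile = ∅ := by
  set t := displacedTriangle hu s with ht
  set t' := displacedTriangle hu s' with ht'
  -- `C` marks the shared vertices. By `exists_tileVertex_eq` a common point has barycentric
  -- coordinate `0` at every other vertex, so the intersection is spanned by the shared vertices,
  -- and at most two are shared.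
  let C : Fin 3 → Prop := fun i => ∃ j, tileVertex s' j = tileVertex s i
  have hC : ∀ i, C i → ∃ j, t.points i = t'.points j := by
    rintro i ⟨j, hj⟩
    refine ⟨j, ?_⟩
    rw [ht, ht', displacedTriangle_points, displacedTriangle_points, displacedVertex,
      displacedVertex, hj]
  have hmem : ∀ x ∈ t.tile ∩ t'.tile, ∃ l : Fin 3 → ℝ, (∀ i, 0 ≤ l i) ∧
      l 0 + l 1 + l 2 = 1 ∧ (∀ i, ¬ C i → l i = 0) ∧
      x = l 0 • t.points 0 + l 1 • t.points 1 + l 2 • t.points 2 := fun x hx => by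
    rw [tile_inter_tile hu h1 h2] at hx
    obtain ⟨p, ⟨hp, hp'⟩, rfl⟩ := hx
    refine ⟨bary s p, hp, ?_, fun i hi => ?_, ?_⟩
    · rw [← sum_bary s p, Fin.sum_univ_three]
    · by_contra hne
      exact hi (exists_tileVertex_eq hp hp' (lt_of_le_of_ne (hp i) (Ne.symm hne)))
    · simp only [plMap_eq u hp, map_add latticeMap (_ + _), map_add latticeMap (_ • _), map_smul,
        Fin.sum_univ_three]
      rfl
  have hnot : ∃ k, ¬ C k := by
    by_contra h
    push Not at h
    exact hs (tileIndex_eq_of_vertices h)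
  obtain ⟨k, hk⟩ := hnot
  obtain ⟨i, j, hij, hik, hjk, hl⟩ : ∃ i j : Fin 3, i ≠ j ∧ i ≠ k ∧ j ≠ k ∧
      ∀ x ∈ t.tile ∩ t'.tile, ∃ a b : ℝ, 0 ≤ a ∧ 0 ≤ b ∧ a + b = 1 ∧
        a • t.points i + b • t.points j = x ∧ (¬ C i → a = 0) ∧ (¬ C j → b = 0) := by
    fin_cases k
    · refine ⟨1, 2, by decide, by decide, by decide, fun x hx => ?_⟩
      obtain ⟨l, l0, lsum, lz, rfl⟩ := hmem x hx
      have hz : l 0 = 0 := lz 0 hk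
      exact ⟨l 1, l 2, l0 1, l0 2, by linarith, by rw [hz, zero_smul, zero_add], lz 1, lz 2⟩
    · refine ⟨0, 2, by decide, by decide, by decide, fun x hx => ?_⟩
      obtain ⟨l, l0, lsum, lz, rfl⟩ := hmem x hx
      have hz : l 1 = 0 := lz 1 hk
      exact ⟨l 0, l 2, l0 0, l0 2, by linarith, by rw [hz, zero_smul, add_zero], lz 0, lz 2⟩
    · refine ⟨0, 1, by decide, by decide, by decide, fun x hx => ?_⟩
      obtain ⟨l, l0, lsum, lz, rfl⟩ := hmem x hx
      have hz : l 2 = 0 := lz 2 hk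
      exact ⟨l 0, l 1, l0 0, l0 1, by linarith, by rw [hz, zero_smul, add_zero], lz 0, lz 1⟩
  by_cases hi : C i
  · obtain ⟨i', hi'⟩ := hC i hi
    by_cases hj : C j
    · obtain ⟨j', hj'⟩ := hC j hj
      refine Or.inl ⟨i, j, i', j', hij, hi', hj', Set.Subset.antisymm (fun x hx => ?_)
        (Set.subset_inter (t.segment_subset_tile i j) ?_)⟩
      · obtain ⟨a, b, ha, hb, hab, hx, -⟩ := hl x hx
        exact ⟨a, b, ha, hb, hab, hx⟩
      · rw [hi', hj']
        exact t'.segment_subset_tile i' j'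
    · refine Or.inr (Or.inl ⟨i, i', hi', Set.Subset.antisymm (fun x hx => ?_) ?_⟩)
      · obtain ⟨a, b, -, -, hab, rfl, -, hb⟩ := hl x hx
        rw [hb hj, add_zero] at hab
        rw [hb hj, hab, one_smul, zero_smul, add_zero]
        exact Set.mem_singleton _
      · rw [Set.singleton_subset_iff]
        exact ⟨t.points_mem_tile i, by rw [hi']; exact t'.points_mem_tile i'⟩
  · by_cases hj : C j
    · obtain ⟨j', hj'⟩ := hC j hj
      refine Or.inr (Or.inl ⟨j, j', hj', Set.Subset.antisymm (fun x hx => ?_) ?_⟩)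
      · obtain ⟨a, b, -, -, hab, rfl, ha, -⟩ := hl x hx
        rw [ha hi, zero_add] at hab
        rw [ha hi, hab, one_smul, zero_smul, zero_add]
        exact Set.mem_singleton _
      · rw [Set.singleton_subset_iff]
        exact ⟨t.points_mem_tile j, by rw [hj']; exact t'.points_mem_tile j'⟩
    · refine Or.inr (Or.inr (Set.eq_empty_of_forall_notMem fun x hx => ?_))
      obtain ⟨a, b, -, -, hab, -, ha, hb⟩ := hl x hx
      rw [ha hi, hb hj] at hab
      norm_num at hab

theorem isVertexToVertex_displaced (h1 : ∀ m n, ‖u (m + 1) n - u m n‖ ≤ 1 / 4)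
    (h2 : ∀ m n, ‖u m (n + 1) - u m n‖ ≤ 1 / 4) :
    IsVertexToVertex (Set.range (displacedTriangle hu)) := by
  rintro _ ⟨s, rfl⟩ _ ⟨s', rfl⟩ h
  exact meet_displacedTriangle hu h1 h2 fun hs => h (by rw [hs])

theorem isTriangleTiling_displaced (h1 : ∀ m n, ‖u (m + 1) n - u m n‖ ≤ 1 / 4)
    (h2 : ∀ m n, ‖u m (n + 1) - u m n‖ ≤ 1 / 4) :
    IsTriangleTiling (Set.range (displacedTriangle hu)) := by
  refine ⟨Set.eq_univ_of_forall fun y => ?_, fun t ht t' ht' hne => ?_⟩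
  · obtain ⟨q, rfl⟩ := latticeMap_surjective y
    obtain ⟨p, rfl⟩ := (plMap_bijective h1 h2).surjective q
    obtain ⟨s, hs⟩ := exists_mem_stdTile p
    refine Set.mem_biUnion ⟨s, rfl⟩ ?_
    rw [tile_displacedTriangle]
    exact ⟨p, hs, rfl⟩
  · have key : ∀ a b : Plane, t.tile ∩ t'.tile ⊆ segment ℝ a b →
        Disjoint (interior t.tile) (interior t'.tile) := fun a b h => by
      rw [Set.disjoint_iff_inter_eq_empty, ← interior_inter, ← Set.subset_empty_iff,
        ← interior_segment_eq_empty a b]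
      exact interior_mono h
    rcases isVertexToVertex_displaced hu h1 h2 t ht t' ht' hne with
      ⟨i, j, _, _, _, _, _, h⟩ | ⟨i, _, _, h⟩ | h
    · exact key _ _ h.subset
    · refine key (t.points i) (t.points i) ?_
      rw [h, segment_same]
    · refine key 0 0 ?_
      rw [h]
      exact Set.empty_subset _

/-- Since `plMap` is injective, equal displaced tiles come from equal standard tiles, and these have
the same vertices. -/
theorem displacedTriangle_injective (h1 : ∀ m n, ‖u (m + 1) n - u m n‖ ≤ 1 / 4)
    (h2 : ∀ m n, ‖u m (n + 1) - u m n‖ ≤ 1 / 4) :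
    Function.Injective (displacedTriangle hu) := by
  intro s s' h
  by_contra hne
  have hinj : Function.Injective fun p => latticeMap (plMap u p) :=
    latticeMap_injective.comp (plMap_bijective h1 h2).injective
  have hst : stdTile s = stdTile s' := by
    have := congrArg PlaneTriangle.tile h
    rw [tile_displacedTriangle, tile_displacedTriangle] at this
    exact hinj.image_injective this
  refine hne (tileIndex_eq_of_vertices fun i => ?_)
  have hb := bary_sum_smul s (l := Pi.single i 1) (by simp)
  have hmem : ∑ k, (Pi.single i 1 : Fin 3 → ℝ) k • coordPoint (tileVertex s k) ∈ stdTile s :=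
    fun k => by
      rw [hb]
      by_cases hk : k = i
      · subst hk; simp
      · simp [hk]
  exact exists_tileVertex_eq hmem (hst ▸ hmem) (by rw [hb]; simp)

end Tiling

/-! ### Side lengths, congruence invariants and perimeters -/

/-- The value of `hexForm` on the side of a displaced triangle joining two vertices. -/
def sideForm (u : ℤ → ℤ → ℝ × ℝ) (s : TileIndex) (i j : Fin 3) : ℝ :=
  hexForm ((displacedVertex u s i).1 - (displacedVertex u s j).1)
    ((displacedVertex u s i).2 - (displacedVertex u s j).2)

theorem hexForm_nonneg (a b : ℝ) : 0 ≤ hexForm a b := by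
  unfold hexForm; nlinarith [sq_nonneg (a + b), sq_nonneg a, sq_nonneg b]

theorem sideForm_self (u : ℤ → ℤ → ℝ × ℝ) (s : TileIndex) (i : Fin 3) : sideForm u s i i = 0 := by
  simp [sideForm, hexForm]

theorem sideForm_comm (u : ℤ → ℤ → ℝ × ℝ) (s : TileIndex) (i j : Fin 3) :
    sideForm u s i j = sideForm u s j i := by
  simp only [sideForm, hexForm]; ring

section Sides

variable {u : ℤ → ℤ → ℝ × ℝ}

theorem dist_sq_displacedTriangle (hu : IsAreaPreserving u) (s : TileIndex) (i j : Fin 3) :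
    dist ((displacedTriangle hu s).points i) ((displacedTriangle hu s).points j) ^ 2 =
      unitSide ^ 2 * sideForm u s i j :=
  dist_latticeMap_sq _ _

theorem dist_displacedTriangle (hu : IsAreaPreserving u) (s : TileIndex) (i j : Fin 3) :
    dist ((displacedTriangle hu s).points i) ((displacedTriangle hu s).points j) =
      unitSide * √(sideForm u s i j) := by
  have h0 : 0 ≤ sideForm u s i j := hexForm_nonneg _ _
  rw [← sq_eq_sq₀ dist_nonneg (mul_nonneg unitSide_pos.le (Real.sqrt_nonneg _)),
    dist_sq_displacedTriangle, mul_pow, Real.sq_sqrt h0]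

/-- Heron's formula for a triangle of unit area. -/
theorem heron_sideForm (hu : IsAreaPreserving u) (s : TileIndex) :
    4 * sideForm u s 1 0 * sideForm u s 2 0
      - (sideForm u s 1 0 + sideForm u s 2 0 - sideForm u s 2 1) ^ 2 = 3 := by
  have h := hu s
  simp only [crossProd, Prod.fst_sub, Prod.snd_sub] at h
  simp only [sideForm, hexForm]
  linear_combination (3 * ((((displacedVertex u s 1).1 - (displacedVertex u s 0).1) *
    ((displacedVertex u s 2).2 - (displacedVertex u s 0).2) -
    ((displacedVertex u s 1).2 - (displacedVertex u s 0).2) *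
    ((displacedVertex u s 2).1 - (displacedVertex u s 0).1)) + 1)) * h

/-- The area fixes the scale: with all three side forms equal to `p`, Heron's formula reads `3 * p ^
2 = 3`. -/
theorem sideForm_eq_one_of_equilateral (hu : IsAreaPreserving u)
    {s : TileIndex} (h : (displacedTriangle hu s).Equilateral) :
    sideForm u s 1 0 = 1 ∧ sideForm u s 2 0 = 1 ∧ sideForm u s 2 1 = 1 := by
  obtain ⟨r, hr⟩ := h
  have hs : unitSide ^ 2 ≠ 0 := pow_ne_zero 2 unitSide_pos.ne'
  have key : ∀ i j : Fin 3, i ≠ j → unitSide ^ 2 * sideForm u s i j = r ^ 2 := fun i j hij => by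
    rw [← dist_sq_displacedTriangle hu, hr i j hij]
  have e1 := mul_left_cancel₀ hs ((key 1 0 (by decide)).trans (key 2 0 (by decide)).symm)
  have e2 := mul_left_cancel₀ hs ((key 2 0 (by decide)).trans (key 2 1 (by decide)).symm)
  have h := heron_sideForm hu s
  have h0 : 0 ≤ sideForm u s 2 1 := hexForm_nonneg _ _
  rw [e1, e2] at h
  have h1 : sideForm u s 2 1 = 1 := by nlinarith
  exact ⟨by rw [e1, e2, h1], by rw [e2, h1], h1⟩

/-- A symmetric function of the side lengths. -/
theorem sum_dist_sq_sub_sq (hu : IsAreaPreserving u) (s : TileIndex) :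
    ∑ i : Fin 3, ∑ j : Fin 3,
      (dist ((displacedTriangle hu s).points i) ((displacedTriangle hu s).points j) ^ 2
        - unitSide ^ 2) ^ 2 =
      unitSide ^ 4 * (3 + 2 * ((sideForm u s 1 0 - 1) ^ 2 + (sideForm u s 2 0 - 1) ^ 2
        + (sideForm u s 2 1 - 1) ^ 2)) := by
  simp only [Fin.sum_univ_three, dist_sq_displacedTriangle hu, sideForm_self,
    sideForm_comm u s 0 1, sideForm_comm u s 0 2, sideForm_comm u s 1 2]
  ring

theorem sideForm_eq_of_isCongruent (hu : IsAreaPreserving u) {s s' : TileIndex}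
    (h : (displacedTriangle hu s).IsCongruent (displacedTriangle hu s')) :
    (sideForm u s 1 0 - 1) ^ 2 + (sideForm u s 2 0 - 1) ^ 2 + (sideForm u s 2 1 - 1) ^ 2 =
      (sideForm u s' 1 0 - 1) ^ 2 + (sideForm u s' 2 0 - 1) ^ 2 + (sideForm u s' 2 1 - 1) ^ 2 := by
  obtain ⟨σ, hσ⟩ := h.exists_perm
  -- Summing over all ordered pairs of vertices makes the expression visibly invariant under the
  -- permutation; the diagonal pairs contribute the same constant for every tile.
  have e := sum_dist_sq_sub_sq hu s'
  simp only [hσ] at e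
  rw [Equiv.sum_comp σ fun i : Fin 3 => ∑ j : Fin 3,
    (dist ((displacedTriangle hu s).points i) ((displacedTriangle hu s).points (σ j)) ^ 2
      - unitSide ^ 2) ^ 2] at e
  have e' : ∀ i : Fin 3, ∑ j : Fin 3, (dist ((displacedTriangle hu s).points i)
      ((displacedTriangle hu s).points (σ j)) ^ 2 - unitSide ^ 2) ^ 2 =
      ∑ j : Fin 3, (dist ((displacedTriangle hu s).points i)
        ((displacedTriangle hu s).points j) ^ 2 - unitSide ^ 2) ^ 2 := fun i =>
    Equiv.sum_comp σ fun j : Fin 3 => (dist ((displacedTriangle hu s).points i)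
      ((displacedTriangle hu s).points j) ^ 2 - unitSide ^ 2) ^ 2
  simp only [e'] at e
  rw [sum_dist_sq_sub_sq hu s] at e
  have := mul_left_cancel₀ (pow_ne_zero 4 unitSide_pos.ne') e
  linarith

theorem perimeter_displacedTriangle (hu : IsAreaPreserving u) (s : TileIndex) :
    (displacedTriangle hu s).perimeter =
      unitSide * (√(sideForm u s 1 0) + √(sideForm u s 2 0) + √(sideForm u s 2 1)) := by
  simp only [PlaneTriangle.perimeter, dist_displacedTriangle hu, sideForm_comm u s 0 1,
    sideForm_comm u s 1 2]
  ring

theorem perimeter_bounds (hu : IsAreaPreserving u)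
    {s : TileIndex} {η : ℝ} (hη0 : 0 ≤ η) (hη1 : η ≤ 1)
    (h10 : |sideForm u s 1 0 - 1| ≤ η) (h20 : |sideForm u s 2 0 - 1| ≤ η)
    (h21 : |sideForm u s 2 1 - 1| ≤ η) :
    unitSide * (3 * (1 - η)) ≤ (displacedTriangle hu s).perimeter ∧
      (displacedTriangle hu s).perimeter ≤ unitSide * (3 * (1 + η)) := by
  have key : ∀ {x : ℝ}, |x - 1| ≤ η → 1 - η ≤ √x ∧ √x ≤ 1 + η := fun {x} hx => by
    rw [abs_le] at hx
    constructor
    · exact Real.le_sqrt_of_sq_le (by nlinarith)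
    · exact Real.sqrt_le_iff.mpr ⟨by linarith, by nlinarith⟩
  have k1 := key h10
  have k2 := key h20
  have k3 := key h21
  rw [perimeter_displacedTriangle hu]
  exact ⟨mul_le_mul_of_nonneg_left (by linarith) unitSide_pos.le,
    mul_le_mul_of_nonneg_left (by linarith) unitSide_pos.le⟩

end Sides

/-! ### The equilateral tiling as the case of zero displacement -/

section Undisplaced

theorem isAreaPreserving_zero : IsAreaPreserving 0 := by
  rintro ⟨m, n, b⟩
  cases b <;> simp [crossProd, displacedVertex, tileVertex, coordPoint]

theorem equilateralTiling_eq : equilateralTiling = Set.range (displacedTriangle isAreaPreserving_zero) := by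
  have hup : ∀ m n : ℤ, (displacedTriangle isAreaPreserving_zero (m, n, true)).points =
      ![latticePoint m n, latticePoint (m + 1) n, latticePoint m (n + 1)] := fun m n => by
    funext i
    rw [displacedTriangle_points]
    fin_cases i <;> simp [displacedVertex, tileVertex, ← latticePoint_eq]
  have hdown : ∀ m n : ℤ, (displacedTriangle isAreaPreserving_zero (m, n, false)).points =
      ![latticePoint (m + 1) (n + 1), latticePoint m (n + 1), latticePoint (m + 1) n] :=
    fun m n => by
    funext i
    rw [displacedTriangle_points]
    fin_cases i <;> simp [displacedVertex, tileVertex, ← latticePoint_eq]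
  ext t
  constructor
  · rintro ⟨m, n, h | h⟩
    · exact ⟨(m, n, true), Affine.Simplex.ext fun i => by rw [h, hup]⟩
    · exact ⟨(m, n, false), Affine.Simplex.ext fun i => by rw [h, hdown]⟩
  · rintro ⟨⟨m, n, b⟩, rfl⟩
    cases b
    · exact ⟨m, n, Or.inr (hdown m n)⟩
    · exact ⟨m, n, Or.inl (hup m n)⟩

theorem equilateral_undisplaced (s : TileIndex) :
    (displacedTriangle isAreaPreserving_zero s).Equilateral := by
  refine ⟨unitSide, fun i j hij => ?_⟩
  have h : sideForm 0 s i j = 1 := by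
    obtain ⟨m, n, b⟩ := s
    cases b <;> fin_cases i <;> fin_cases j <;>
      simp [sideForm, displacedVertex, tileVertex, coordPoint, hexForm] at hij ⊢
  rw [dist_displacedTriangle, h, Real.sqrt_one, mul_one]

/-- Translation of the triangles by a lattice vector. -/
def shiftIndex (a b : ℤ) (s : TileIndex) : TileIndex := (s.1 + a, s.2.1 + b, s.2.2)

theorem shiftIndex_surjective (a b : ℤ) : Function.Surjective (shiftIndex a b) := fun s =>
  ⟨(s.1 - a, s.2.1 - b, s.2.2), by simp [shiftIndex]⟩

theorem tile_shiftIndex (a b : ℤ) (s : TileIndex) :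
    (displacedTriangle isAreaPreserving_zero (shiftIndex a b s)).tile =
      (fun x => latticeMap (a, b) + x) '' (displacedTriangle isAreaPreserving_zero s).tile := by
  have h := AffineMap.image_convexHull (AffineEquiv.constVAdd ℝ Plane (latticeMap (a, b)) :
    Plane →ᵃ[ℝ] Plane) (Set.range (displacedTriangle isAreaPreserving_zero s).points)
  refine Eq.trans ?_ h.symm
  rw [← Set.range_comp]
  unfold PlaneTriangle.tile
  have hv : ∀ i : Fin 3, coordPoint (tileVertex (shiftIndex a b s) i) =
      ((a : ℝ), (b : ℝ)) + coordPoint (tileVertex s i) := fun i => by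
    obtain ⟨m, n, c⟩ := s
    cases c <;> fin_cases i <;>
      simp [shiftIndex, tileVertex, coordPoint] <;> constructor <;> ring
  congr 2
  funext i
  change latticeMap (coordPoint (tileVertex (shiftIndex a b s) i) + 0) =
    latticeMap (a, b) + latticeMap (coordPoint (tileVertex s i) + 0)
  rw [add_zero, add_zero, hv, map_add]

theorem isPeriodicTiling_equilateralTiling : IsPeriodicTiling equilateralTiling := by
  refine ⟨![latticeMap (((1 : ℤ) : ℝ), ((0 : ℤ) : ℝ)), latticeMap (((0 : ℤ) : ℝ), ((1 : ℤ) : ℝ))],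
    ?_, ?_⟩
  · rw [LinearIndependent.pair_iff]
    intro c d h
    rw [← map_smul, ← map_smul, ← map_add] at h
    have h' := latticeMap_injective (h.trans (map_zero latticeMap).symm)
    simpa using h'
  · have key : ∀ a b : ℤ, (fun A : Set Plane => (fun x => latticeMap ((a : ℝ), (b : ℝ)) + x) '' A) ''
        (PlaneTriangle.tile '' equilateralTiling) = PlaneTriangle.tile '' equilateralTiling :=
      fun a b => by
      rw [equilateralTiling_eq, ← Set.range_comp, ← Set.range_comp,
        ← (shiftIndex_surjective a b).range_comp (PlaneTriangle.tile ∘ _)]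
      congr 1
      funext s
      exact (tile_shiftIndex a b s).symm
    intro k
    fin_cases k
    · exact key 1 0
    · exact key 0 1

end Undisplaced

theorem areClose_displaced {u : ℤ → ℤ → ℝ × ℝ} (hu : IsAreaPreserving u)
    (h1 : ∀ m n, ‖u (m + 1) n - u m n‖ ≤ 1 / 4) (h2 : ∀ m n, ‖u m (n + 1) - u m n‖ ≤ 1 / 4)
    {ε : ℝ} (hε : ∀ m n, 2 * unitSide * ‖u m n‖ ≤ ε) :
    AreClose ε (Set.range (displacedTriangle hu)) equilateralTiling := by
  have hinj := displacedTriangle_injective hu h1 h2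
  have hinj0 := displacedTriangle_injective isAreaPreserving_zero (by simp) (by simp)
  rw [equilateralTiling_eq]
  refine ⟨(Equiv.ofInjective _ hinj).symm.trans (Equiv.ofInjective _ hinj0), ?_⟩
  rintro ⟨_, s, rfl⟩
  refine ⟨1, fun i k => ?_⟩
  rw [Equiv.trans_apply, Equiv.ofInjective_symm_apply hinj s, Equiv.ofInjective_apply]
  change |latticeMap (displacedVertex u s i) k - latticeMap (displacedVertex 0 s i) k| ≤ ε
  have e : latticeMap (displacedVertex u s i) k - latticeMap (displacedVertex 0 s i) k =
      latticeMap (u (tileVertex s i).1 (tileVertex s i).2) k := by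
    simp [displacedVertex]
  rw [e]
  refine le_trans ?_ (hε (tileVertex s i).1 (tileVertex s i).2)
  generalize u (tileVertex s i).1 (tileVertex s i).2 = v
  have hs := unitSide_pos
  have n1 := norm_fst_le v
  have n2 := norm_snd_le v
  rw [Real.norm_eq_abs] at n1 n2
  have hv := norm_nonneg v
  fin_cases k
  · change |unitSide * (v.1 + v.2 / 2)| ≤ _
    rw [abs_mul, abs_of_pos hs, mul_comm 2, mul_assoc]
    refine mul_le_mul_of_nonneg_left ?_ hs.le
    have := abs_add_le v.1 (v.2 / 2)
    rw [abs_div, abs_two] at this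
    linarith
  · change |unitSide * (√3 / 2 * v.2)| ≤ _
    rw [abs_mul, abs_of_pos hs, mul_comm 2, mul_assoc]
    refine mul_le_mul_of_nonneg_left ?_ hs.le
    rw [abs_mul, abs_of_nonneg (by positivity)]
    have h3 : √3 / 2 ≤ 1 := by
      have : √3 ≤ 2 := Real.sqrt_le_iff.mpr ⟨by norm_num, by norm_num⟩
      linarith
    have := mul_le_mul h3 n2 (abs_nonneg _) zero_le_one
    linarith

/-! ### From wave fields to displacements -/

namespace WaveField

/-- The displacement of the lattice points determined by a wave field. -/
noncomputable def displacement (F : WaveField ℝ) (m n : ℤ) : ℝ × ℝ :=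
  intPrimitive (fun i => (F.diag i 0, F.column i 0 - F.diag i 0)) m
    + intPrimitive (fun j => (F.row m j + F.diagLeft m j, -F.diagLeft m j)) n

theorem displacement_add_one_right (F : WaveField ℝ) (m n : ℤ) :
    F.displacement m (n + 1) =
      F.displacement m n + (F.row m n + F.diagLeft m n, -F.diagLeft m n) := by
  rw [displacement, intPrimitive_add_one, ← add_assoc]
  rfl

/-- `displacement` integrates along row `0` and then along column `m`. The closing conditions make
the integral independent of the path, so horizontal increments are correct in every row, by
induction away from row `0` in both directions. -/
theorem IsSolution.displacement_add_one_left {F : WaveField ℝ} (hF : F.IsSolution) (m n : ℤ) :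
    F.displacement (m + 1) n =
      F.displacement m n + (F.diag m n, F.column m n - F.diag m n) := by
  have hstep : ∀ k, (F.displacement (m + 1) (k + 1) =
      F.displacement m (k + 1) + (F.diag m (k + 1), F.column m (k + 1) - F.diag m (k + 1))) ↔
      F.displacement (m + 1) k =
        F.displacement m k + (F.diag m k, F.column m k - F.diag m k) := fun k => by
    have c1 := hF.closed_fst m k
    have c2 := hF.closed_snd m k
    rw [displacement_add_one_right, displacement_add_one_right]
    simp only [Prod.ext_iff, Prod.fst_add, Prod.snd_add]
    constructor
    · rintro ⟨e1, e2⟩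
      constructor <;> linarith
    · rintro ⟨e1, e2⟩
      constructor <;> linarith
  induction n with
  | zero => simp [displacement, intPrimitive_add_one]
  | succ k ih => exact (hstep k).mpr ih
  | pred k ih =>
    refine (hstep _).mp ?_
    rwa [sub_add_cancel]

section Edges

variable {F : WaveField ℝ}

theorem IsSolution.up_edges (hF : F.IsSolution) (m n : ℤ) :
    (displacedVertex F.displacement (m, n, true) 1).1
      - (displacedVertex F.displacement (m, n, true) 0).1 = 1 + F.diag m n ∧
    (displacedVertex F.displacement (m, n, true) 1).2
      - (displacedVertex F.displacement (m, n, true) 0).2 = F.column m n - F.diag m n ∧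
    (displacedVertex F.displacement (m, n, true) 2).1
      - (displacedVertex F.displacement (m, n, true) 0).1 = F.row m n + F.diagLeft m n ∧
    (displacedVertex F.displacement (m, n, true) 2).2
      - (displacedVertex F.displacement (m, n, true) 0).2 = 1 - F.diagLeft m n := by
  have eA := hF.displacement_add_one_left m n
  have eB := F.displacement_add_one_right m n
  simp only [displacedVertex, tileVertex, coordPoint, Matrix.cons_val, eA, eB, Prod.fst_add,
    Prod.snd_add]
  push_cast
  refine ⟨?_, ?_, ?_, ?_⟩ <;> ring

theorem IsSolution.down_edges (hF : F.IsSolution) (m n : ℤ) :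
    (displacedVertex F.displacement (m, n, false) 1).1
      - (displacedVertex F.displacement (m, n, false) 0).1 = -(1 + F.diag m (n + 1)) ∧
    (displacedVertex F.displacement (m, n, false) 1).2
      - (displacedVertex F.displacement (m, n, false) 0).2 =
        -(F.column m (n + 1) - F.diag m (n + 1)) ∧
    (displacedVertex F.displacement (m, n, false) 2).1
      - (displacedVertex F.displacement (m, n, false) 0).1 =
        -(F.row (m + 1) n + F.diagLeft (m + 1) n) ∧
    (displacedVertex F.displacement (m, n, false) 2).2
      - (displacedVertex F.displacement (m, n, false) 0).2 = -(1 - F.diagLeft (m + 1) n) := by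
  have eA := hF.displacement_add_one_left m (n + 1)
  have eB := F.displacement_add_one_right (m + 1) n
  have eA1 := congrArg Prod.fst eA
  have eA2 := congrArg Prod.snd eA
  have eB1 := congrArg Prod.fst eB
  have eB2 := congrArg Prod.snd eB
  simp only [Prod.fst_add, Prod.snd_add] at eA1 eA2 eB1 eB2
  simp only [displacedVertex, tileVertex, coordPoint, Matrix.cons_val, Prod.fst_add, Prod.snd_add]
  push_cast
  refine ⟨?_, ?_, ?_, ?_⟩ <;> linarith

theorem IsSolution.isAreaPreserving (hF : F.IsSolution) :
    IsAreaPreserving F.displacement := by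
  rintro ⟨m, n, b⟩
  cases b
  · obtain ⟨h1, h2, h3, h4⟩ := hF.down_edges m n
    have h := hF.down m n
    rw [crossProd, Prod.fst_sub, Prod.snd_sub, Prod.fst_sub, Prod.snd_sub, h1, h2, h3, h4]
    linear_combination h
  · obtain ⟨h1, h2, h3, h4⟩ := hF.up_edges m n
    have h := hF.up m n
    rw [crossProd, Prod.fst_sub, Prod.snd_sub, Prod.fst_sub, Prod.snd_sub, h1, h2, h3, h4]
    linear_combination h

theorem IsSolution.sideForm_up (hF : F.IsSolution) (m n : ℤ) :
    sideForm F.displacement (m, n, true) 1 0 = hexForm (1 + F.diag m n)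
      (F.column m n - F.diag m n) ∧
    sideForm F.displacement (m, n, true) 2 0 = hexForm (F.row m n + F.diagLeft m n)
      (1 - F.diagLeft m n) ∧
    sideForm F.displacement (m, n, true) 2 1 =
      hexForm (F.row m n + F.diagLeft m n - (1 + F.diag m n))
        (1 - F.diagLeft m n - (F.column m n - F.diag m n)) := by
  obtain ⟨h1, h2, h3, h4⟩ := hF.up_edges m n
  refine ⟨by rw [sideForm, h1, h2], by rw [sideForm, h3, h4], ?_⟩
  rw [← h1, ← h2, ← h3, ← h4, sub_sub_sub_cancel_right, sub_sub_sub_cancel_right]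
  rfl

theorem IsSolution.sideForm_down (hF : F.IsSolution) (m n : ℤ) :
    sideForm F.displacement (m, n, false) 1 0 = hexForm (1 + F.diag m (n + 1))
      (F.column m (n + 1) - F.diag m (n + 1)) ∧
    sideForm F.displacement (m, n, false) 2 0 =
      hexForm (F.row (m + 1) n + F.diagLeft (m + 1) n) (1 - F.diagLeft (m + 1) n) ∧
    sideForm F.displacement (m, n, false) 2 1 =
      hexForm (F.row (m + 1) n + F.diagLeft (m + 1) n - (1 + F.diag m (n + 1)))
        (1 - F.diagLeft (m + 1) n - (F.column m (n + 1) - F.diag m (n + 1))) := by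
  have hneg : ∀ a b : ℝ, hexForm (-a) (-b) = hexForm a b := fun a b => by
    unfold hexForm; ring
  obtain ⟨h1, h2, h3, h4⟩ := hF.down_edges m n
  refine ⟨by rw [sideForm, h1, h2, hneg], by rw [sideForm, h3, h4, hneg], ?_⟩
  rw [← hneg, sideForm]
  congr 1 <;> linarith

theorem IsSolution.tileDefect_eq (hF : F.IsSolution) (s : TileIndex) :
    F.tileDefect s = (sideForm F.displacement s 1 0 - 1) ^ 2
      + (sideForm F.displacement s 2 0 - 1) ^ 2 + (sideForm F.displacement s 2 1 - 1) ^ 2 := by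
  obtain ⟨m, n, b⟩ := s
  cases b
  · obtain ⟨h1, h2, h3⟩ := hF.sideForm_down m n
    rw [h1, h2, h3]
    rfl
  · obtain ⟨h1, h2, h3⟩ := hF.sideForm_up m n
    rw [h1, h2, h3]
    rfl

end Edges

theorem abs_hexForm_sub_one_le {a b c c' κ : ℝ} (hκ : κ ≤ 1) (ha : |a| ≤ κ)
    (hb : |b| ≤ κ) (hc : |c| ≤ κ) (hc' : |c'| ≤ κ) :
    |hexForm (1 + c) (b - c) - 1| ≤ 33 * κ ∧ |hexForm (a + c') (1 - c') - 1| ≤ 33 * κ ∧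
      |hexForm (a + c' - (1 + c)) (1 - c' - (b - c)) - 1| ≤ 33 * κ := by
  have hκ0 : 0 ≤ κ := (abs_nonneg a).trans ha
  -- Each side form deviates from `1` by a linear part of at most `6 * κ` and a quadratic part of at
  -- most `27 * κ ^ 2`; together `33 * κ`, using `κ ≤ 1`.
  have hquad : ∀ {x y : ℝ}, |x| ≤ 3 * κ → |y| ≤ 3 * κ → |x ^ 2 + x * y + y ^ 2| ≤ 27 * κ :=
    fun {x y} hx hy => by
      rw [abs_le] at hx hy ⊢
      constructor
      · nlinarith [sq_nonneg (x + y), sq_nonneg x, sq_nonneg y]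
      · nlinarith [mul_nonneg (sub_nonneg.mpr hx.2) (by linarith : 0 ≤ x + 3 * κ),
          mul_nonneg (sub_nonneg.mpr hy.2) (by linarith : 0 ≤ y + 3 * κ), sq_nonneg (x - y),
          mul_nonneg hκ0 (sub_nonneg.mpr hκ)]
  rw [abs_le] at ha hb hc hc'
  have q1 := hquad (x := c) (y := b - c) (by rw [abs_le]; constructor <;> linarith)
    (by rw [abs_le]; constructor <;> linarith)
  have q2 := hquad (x := a + c') (y := -c') (by rw [abs_le]; constructor <;> linarith)
    (by rw [abs_le]; constructor <;> linarith)
  have q3 := hquad (x := a + c' - c) (y := -c' - b + c)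
    (by rw [abs_le]; constructor <;> linarith) (by rw [abs_le]; constructor <;> linarith)
  rw [abs_le] at q1 q2 q3
  unfold hexForm
  refine ⟨?_, ?_, ?_⟩ <;> rw [abs_le] <;> constructor <;> linarith

section Small

variable {F : WaveField ℝ} {κ : ℝ}

theorem abs_le_of_small
    (hsmall : ∀ m n, |F.row m n| ≤ κ * quadWeight n ∧ |F.column m n| ≤ κ * quadWeight m ∧
      |F.diag m n| ≤ κ * quadWeight (m + n) ∧ |F.diagLeft m n| ≤ κ * quadWeight (m + n))
    (hκ : 0 ≤ κ) (m n : ℤ) : |F.row m n| ≤ κ ∧ |F.column m n| ≤ κ ∧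
    |F.diag m n| ≤ κ ∧ |F.diagLeft m n| ≤ κ := by
  have hw := fun k => mul_le_of_le_one_right hκ (quadWeight_le_one k)
  obtain ⟨h1, h2, h3, h4⟩ := hsmall m n
  exact ⟨h1.trans (hw _), h2.trans (hw _), h3.trans (hw _), h4.trans (hw _)⟩

/-- Summability of the weights is what keeps the displacement bounded over the whole plane; small
edge perturbations alone would allow it to drift to infinity. -/
theorem norm_displacement_le
    (hsmall : ∀ m n, |F.row m n| ≤ κ * quadWeight n ∧ |F.column m n| ≤ κ * quadWeight m ∧
      |F.diag m n| ≤ κ * quadWeight (m + n) ∧ |F.diagLeft m n| ≤ κ * quadWeight (m + n))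
    (m n : ℤ) : ‖F.displacement m n‖ ≤ κ * (4 * quadMass) := by
  have s1 : HasSum (fun i => 2 * κ * quadWeight i) (2 * κ * quadMass) :=
    hasSum_quadWeight.mul_left _
  have s2 : HasSum (fun j => κ * (quadWeight j + quadWeight (j + m)))
      (κ * (quadMass + quadMass)) :=
    (hasSum_quadWeight.add (hasSum_quadWeight_add m)).mul_left _
  have b1 : ‖intPrimitive (fun i => (F.diag i 0, F.column i 0 - F.diag i 0)) m‖
      ≤ 2 * κ * quadMass := by
    rw [← s1.tsum_eq]
    refine norm_intPrimitive_le s1.summable (fun i => ?_) m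
    obtain ⟨-, hc, hd, -⟩ := hsmall i 0
    rw [add_zero] at hd
    have := abs_sub (F.column i 0) (F.diag i 0)
    have h0 := abs_nonneg (F.diag i 0)
    refine max_le ?_ ?_
    · change |F.diag i 0| ≤ _; linarith
    · change |F.column i 0 - F.diag i 0| ≤ _; linarith
  have b2 : ‖intPrimitive (fun j => (F.row m j + F.diagLeft m j, -F.diagLeft m j)) n‖
      ≤ κ * (quadMass + quadMass) := by
    rw [← s2.tsum_eq]
    refine norm_intPrimitive_le s2.summable (fun j => ?_) n
    obtain ⟨hr, -, -, hd⟩ := hsmall m j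
    rw [add_comm m j] at hd
    have := abs_add_le (F.row m j) (F.diagLeft m j)
    have h0 := abs_nonneg (F.row m j)
    refine max_le ?_ ?_
    · change |F.row m j + F.diagLeft m j| ≤ _; linarith
    · change |-F.diagLeft m j| ≤ _; rw [abs_neg]; linarith
  unfold displacement
  linarith [norm_add_le_of_le b1 b2]

theorem IsSolution.abs_sideForm_sub_one_le (hκ1 : κ ≤ 1)
    (hsmall : ∀ m n, |F.row m n| ≤ κ * quadWeight n ∧ |F.column m n| ≤ κ * quadWeight m ∧
      |F.diag m n| ≤ κ * quadWeight (m + n) ∧ |F.diagLeft m n| ≤ κ * quadWeight (m + n))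
    (hF : F.IsSolution) (hκ : 0 ≤ κ) (s : TileIndex) :
    |sideForm F.displacement s 1 0 - 1| ≤ 33 * κ ∧ |sideForm F.displacement s 2 0 - 1| ≤ 33 * κ ∧
      |sideForm F.displacement s 2 1 - 1| ≤ 33 * κ := by
  have hs := abs_le_of_small hsmall hκ
  obtain ⟨m, n, b⟩ := s
  cases b
  · obtain ⟨h1, h2, h3⟩ := hF.sideForm_down m n
    rw [h1, h2, h3]
    exact abs_hexForm_sub_one_le hκ1 (hs (m + 1) n).1 (hs m (n + 1)).2.1 (hs m (n + 1)).2.2.1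
      (hs (m + 1) n).2.2.2
  · obtain ⟨h1, h2, h3⟩ := hF.sideForm_up m n
    rw [h1, h2, h3]
    exact abs_hexForm_sub_one_le hκ1 (hs m n).1 (hs m n).2.1 (hs m n).2.2.1 (hs m n).2.2.2

theorem norm_displacement_sub_le
    (hsmall : ∀ m n, |F.row m n| ≤ κ * quadWeight n ∧ |F.column m n| ≤ κ * quadWeight m ∧
      |F.diag m n| ≤ κ * quadWeight (m + n) ∧ |F.diagLeft m n| ≤ κ * quadWeight (m + n))
    (hF : F.IsSolution) (hκ : 0 ≤ κ) (m n : ℤ) :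
    ‖F.displacement (m + 1) n - F.displacement m n‖ ≤ 2 * κ ∧
      ‖F.displacement m (n + 1) - F.displacement m n‖ ≤ 2 * κ := by
  obtain ⟨h1, h2, h3, h4⟩ := abs_le_of_small hsmall hκ m n
  rw [hF.displacement_add_one_left, displacement_add_one_right, add_sub_cancel_left,
    add_sub_cancel_left]
  constructor
  · refine max_le ?_ ?_
    · change |F.diag m n| ≤ _; linarith
    · exact (abs_sub _ _).trans (by linarith)
  · refine max_le ?_ ?_
    · exact (abs_add_le _ _).trans (by linarith)
    · change |-F.diagLeft m n| ≤ _; rw [abs_neg]; linarith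

end Small

end WaveField

/-! ### Assembly of the theorem -/

theorem exists_close_tiling {ε δ : ℝ} (hε : 0 < ε) (hδ : 0 < δ) : ∃ 𝒯 : Set PlaneTriangle,
    IsTriangleTiling 𝒯 ∧ IsVertexToVertex 𝒯 ∧ HasUnitArea 𝒯 ∧
    (∀ t ∈ 𝒯, ∀ t' ∈ 𝒯, t ≠ t' → ¬ t.IsCongruent t') ∧
    (∀ t ∈ 𝒯, ¬ t.Equilateral) ∧
    AreClose ε 𝒯 equilateralTiling ∧
    ∀ t ∈ 𝒯, ∀ t' ∈ 𝒯, t.perimeter / t'.perimeter ≤ 1 + δ := by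
  have hs := unitSide_pos
  have hS := quadMass_nonneg
  -- With `η = 33 * κ` the first bound gives `η ≤ 1 / 2` (and more than the `1 / 4` needed for
  -- bijectivity) and the second `η ≤ δ / 4`; these yield `1 + η ≤ (1 + δ) * (1 - η)`. The third
  -- matches `2 * unitSide` times the displacement bound `4 * κ * quadMass`; the `+ 1` makes the
  -- divisor positive without a lower bound on `quadMass`.
  obtain ⟨κ, hκ0, hκ1, hκδ, hκε⟩ : ∃ κ : ℝ, 0 < κ ∧ κ ≤ 1 / 66 ∧ κ ≤ δ / 132 ∧
      κ * (8 * unitSide * (quadMass + 1)) ≤ ε := by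
    refine ⟨min (1 / 66) (min (δ / 132) (ε / (8 * unitSide * (quadMass + 1)))), ?_, ?_, ?_, ?_⟩
    · refine lt_min (by norm_num) (lt_min (by positivity) (by positivity))
    · exact min_le_left _ _
    · exact (min_le_right _ _).trans (min_le_left _ _)
    · rw [← le_div_iff₀ (by positivity)]
      exact (min_le_right _ _).trans (min_le_right _ _)
  obtain ⟨F, hF, hsmall, hinj, hne⟩ := WaveField.exists_solution hκ0
  have hu := hF.isAreaPreserving
  have hdiff := WaveField.norm_displacement_sub_le hsmall hF hκ0.le
  have h1 : ∀ m n, ‖F.displacement (m + 1) n - F.displacement m n‖ ≤ 1 / 4 := fun m n =>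
    (hdiff m n).1.trans (by linarith)
  have h2 : ∀ m n, ‖F.displacement m (n + 1) - F.displacement m n‖ ≤ 1 / 4 := fun m n =>
    (hdiff m n).2.trans (by linarith)
  refine ⟨Set.range (displacedTriangle hu), isTriangleTiling_displaced hu h1 h2,
    isVertexToVertex_displaced hu h1 h2, hasUnitArea_displaced hu, ?_, ?_,
    areClose_displaced hu h1 h2 fun m n => ?_, ?_⟩
  · rintro _ ⟨s, rfl⟩ _ ⟨s', rfl⟩ hss h
    refine hss (congrArg _ (hinj ?_))
    rw [hF.tileDefect_eq, hF.tileDefect_eq]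
    exact sideForm_eq_of_isCongruent hu h
  · rintro _ ⟨s, rfl⟩ h
    refine hne s ?_
    obtain ⟨e1, e2, e3⟩ := sideForm_eq_one_of_equilateral hu h
    rw [hF.tileDefect_eq, e1, e2, e3]
    norm_num
  · have h := mul_le_mul_of_nonneg_left (WaveField.norm_displacement_le hsmall m n)
      (by positivity : 0 ≤ 2 * unitSide)
    have : 0 ≤ κ * unitSide := by positivity
    linarith
  · have hη1 : 33 * κ ≤ 1 / 2 := by linarith
    have hp : ∀ s, unitSide * (3 * (1 - 33 * κ)) ≤ (displacedTriangle hu s).perimeter ∧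
        (displacedTriangle hu s).perimeter ≤ unitSide * (3 * (1 + 33 * κ)) := fun s => by
      obtain ⟨b1, b2, b3⟩ := hF.abs_sideForm_sub_one_le (by linarith) hsmall hκ0.le s
      exact perimeter_bounds hu (by linarith) (by linarith) b1 b2 b3
    rintro _ ⟨s, rfl⟩ _ ⟨s', rfl⟩
    have hpos : 0 < unitSide * (3 * (1 - 33 * κ)) := mul_pos hs (by linarith)
    rw [div_le_iff₀ (hpos.trans_le (hp s').1)]
    refine (hp s).2.trans (le_trans ?_ (mul_le_mul_of_nonneg_left (hp s').1 (by linarith)))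
    rw [mul_left_comm (1 + δ)]
    refine mul_le_mul_of_nonneg_left ?_ hs.le
    nlinarith [mul_le_mul_of_nonneg_left hη1 hδ.le]

theorem theorem1 :
    (IsTriangleTiling equilateralTiling ∧ IsVertexToVertex equilateralTiling ∧
      IsPeriodicTiling equilateralTiling ∧ HasUnitArea equilateralTiling ∧
      ∀ t ∈ equilateralTiling, t.Equilateral) ∧
    ∀ ε > (0 : ℝ), ∀ δ > (0 : ℝ), ∃ 𝒯 : Set PlaneTriangle,
      IsTriangleTiling 𝒯 ∧ IsVertexToVertex 𝒯 ∧ HasUnitArea 𝒯 ∧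
      (∀ t ∈ 𝒯, ∀ t' ∈ 𝒯, t ≠ t' → ¬ t.IsCongruent t') ∧
      (∀ t ∈ 𝒯, ¬ t.Equilateral) ∧
      AreClose ε 𝒯 equilateralTiling ∧
      ∀ t ∈ 𝒯, ∀ t' ∈ 𝒯, t.perimeter / t'.perimeter ≤ 1 + δ := by
  refine ⟨⟨?_, ?_, isPeriodicTiling_equilateralTiling, ?_, ?_⟩,
    fun ε hε δ hδ => exists_close_tiling hε hδ⟩
  · rw [equilateralTiling_eq]
    exact isTriangleTiling_displaced _ (by simp) (by simp)
  · rw [equilateralTiling_eq]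
    exact isVertexToVertex_displaced _ (by simp) (by simp)
  · rw [equilateralTiling_eq]
    exact hasUnitArea_displaced _
  · rw [equilateralTiling_eq]
    rintro _ ⟨s, rfl⟩
    exact equilateral_undisplaced s
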